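/- Consider the following two-way-search algorithm for incremental cycle detection on a fixed set of $n$ vertices, for $m$ arc insertions, with parameter $\Delta=\min\{m^{1/2},n^{2/3}\}$. Each vertex $x$ has a level $k(x)$, an index $i(x)$, a set $\mathit{out}(x)$ of its outgoing arcs and a set $\mathit{in}(x)$ of those arcs $(u,x)$ with $k(u)=k(x)$. Initially there are no arcs, all levels are $1$, the indices are distinct integers between $-n$ and $-1$, and $\mathit{index}=-n$. An arc $(v,w)$ is inserted as follows. 1. If $(k(v),i(v))<(k(w),i(w))$ lexicographically, go to step 5. 2. (Backward search.) Unmark all vertices, let $B$ and $F$ be empty lists and $\mathit{arcs}=0$, and execute $\mathrm{Bvisit}(v)$. Here $\mathrm{Bvisit}(y)$ marks $y$, executes $\mathrm{Btraverse}(x,y)$ for each $(x,y)\in\mathit{in}(y)$, and then appends $y$ to $B$. $\mathrm{Btraverse}(x,y)$: if $x=w$, stop and report a cycle; otherwise increase $\mathit{arcs}$ by $1$; if now $\mathit{arcs}\ge\Delta$, abort the search, set $k(w)=k(v)+1$, $\mathit{in}(w)=\emptyset$, $B=[\,]$ and go to step 3; otherwise, if $x$ is unmarked, execute $\mathrm{Bvisit}(x)$.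 If the search ends without being aborted and without reporting a cycle: if $k(w)=k(v)$, go to step 4; otherwise set $k(w)=k(v)$ and $\mathit{in}(w)=\emptyset$. 3. (Forward search.) Execute $\mathrm{Fvisit}(w)$. Here $\mathrm{Fvisit}(x)$ executes $\mathrm{Ftraverse}(x,y)$ for each $(x,y)\in\mathit{out}(x)$, and then puts $x$ at the front of $F$. $\mathrm{Ftraverse}(x,y)$: if $y=v$ or $y$ is in $B$, stop and report a cycle; otherwise, if $k(y)<k(w)$, set $k(y)=k(w)$ and $\mathit{in}(y)=\emptyset$ and execute $\mathrm{Fvisit}(y)$; after that, if $k(y)=k(w)$, add $(x,y)$ to $\mathit{in}(y)$. 4. (Re-index.) For the vertices $x$ of the concatenation of $B$ and $F$, from the last to the first, decrease $\mathit{index}$ by $1$ and set $i(x)=\mathit{index}$. 5. Add $(v,w)$ to $\mathit{out}(v)$ and, if $k(v)=k(w)$, to $\mathit{in}(w)$. Time is measured by the number of executed lines (elementary operations, each of unit cost). The loops over $\mathit{in}(y)$ and $\mathit{out}(x)$ may go through the arcs in any order. **Theorem.** There is a constant $c>0$ such that for all $n$ and $m$ with $m\le n(n-1)/2$, and for every admissible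 initial assignment of indices, there is a sequence of $m$ distinct arcs on the $n$ vertices, together forming a directed acyclic graph, such that the algorithm can process the sequence, and every complete execution of the algorithm on this sequence (whatever the orders of the loops) inserts all $m$ arcs without reporting a cycle and takes total time at least $c\cdot\min\{m^{1/2},n^{2/3}\}\cdot m$. -/

import Mathlib

/-!
The two-way-search algorithm for incremental cycle detection in sparse directed graphs, as a
big-step semantics with a step count. The order in which a loop goes through a set of arcs is
not determined by the algorithm, so executions form a relation and not a function.

Time: every executed line of the procedures (an assignment, a comparison, the test of a loop, a
marking, a membership test, the addition of an element to a list or a set, emptying a set or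
unmarking all vertices) takes one unit. All numbers are polynomial in `n`, so this is the usual
unit-cost measure, up to constant factors.
-/

namespace SparseCycle

variable {V : Type*} [DecidableEq V]

/-- `l` lists every element of `S` exactly once. -/
def Enumerates (l : List V) (S : Finset V) : Prop :=
  l.Nodup ∧ l.toFinset = S

/-- The data kept between arc insertions. An arc `(v, w)` of `out v` is stored as its head `w`,
an arc `(u, v)` of `inn v` as its tail `u`. -/
structure State (V : Type*) where
  /-- The level `k v`. -/
  level : V → ℕ
  /-- The index `i v`. -/
  idx : V → ℤ
  /-- The smallest index assigned so far. -/
  low : ℤ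
  /-- The outgoing arcs. -/
  out : V → Finset V
  /-- The incoming arcs whose tail is on the same level. -/
  inn : V → Finset V

/-! ### Backward search -/

/-- The data changed by the backward search. -/
structure BState (V : Type*) where
  marked : Finset V
  B : List V
  arcs : ℕ

/-- How a backward search, or a part of it, ends: normally, because it has traversed too many
arcs, or because it has found a cycle. -/
inductive BResult (V : Type*) where
  | done (s : BState V)
  | abort
  | cycle

/-- The procedures of the backward search; `loop y l` is what remains of the loop of `visit y`
when the arcs `(x, y)` with `x` in `l` are still to be traversed. -/
inductive BCall (V : Type*) where
  | visit (y : V)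
  | loop (y : V) (l : List V)
  | traverse (x y : V)

/-- `BackExec inn w Δ call s r t`: with incoming arc sets `inn`, during the insertion of an arc
with head `w`, the call started in `s` can end with result `r` after `t` units of time. -/
inductive BackExec (inn : V → Finset V) (w : V) (Δ : ℝ) :
    BCall V → BState V → BResult V → ℕ → Prop
  | visit_done {y : V} {l : List V} {s s' : BState V} {t : ℕ} (hl : Enumerates l (inn y))
      (h : BackExec inn w Δ (.loop y l) { s with marked := insert y s.marked } (.done s') t) :
      BackExec inn w Δ (.visit y) s (.done { s' with B := s'.B ++ [y] }) (t + 2)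
  | visit_abort {y : V} {l : List V} {s : BState V} {t : ℕ} (hl : Enumerates l (inn y))
      (h : BackExec inn w Δ (.loop y l) { s with marked := insert y s.marked } .abort t) :
      BackExec inn w Δ (.visit y) s .abort (t + 1)
  | visit_cycle {y : V} {l : List V} {s : BState V} {t : ℕ} (hl : Enumerates l (inn y))
      (h : BackExec inn w Δ (.loop y l) { s with marked := insert y s.marked } .cycle t) :
      BackExec inn w Δ (.visit y) s .cycle (t + 1)
  | loop_nil {y : V} {s : BState V} : BackExec inn w Δ (.loop y []) s (.done s) 1
  | loop_cons {x y : V} {l : List V} {s s' : BState V} {r : BResult V} {t t' : ℕ}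
      (h : BackExec inn w Δ (.traverse x y) s (.done s') t)
      (h' : BackExec inn w Δ (.loop y l) s' r t') :
      BackExec inn w Δ (.loop y (x :: l)) s r (1 + t + t')
  | loop_abort {x y : V} {l : List V} {s : BState V} {t : ℕ}
      (h : BackExec inn w Δ (.traverse x y) s .abort t) :
      BackExec inn w Δ (.loop y (x :: l)) s .abort (1 + t)
  | loop_cycle {x y : V} {l : List V} {s : BState V} {t : ℕ}
      (h : BackExec inn w Δ (.traverse x y) s .cycle t) :
      BackExec inn w Δ (.loop y (x :: l)) s .cycle (1 + t)
  | traverse_cycle {x y : V} {s : BState V} (hx : x = w) :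
      BackExec inn w Δ (.traverse x y) s .cycle 2
  | traverse_abort {x y : V} {s : BState V} (hx : x ≠ w) (hΔ : Δ ≤ ((s.arcs + 1 : ℕ) : ℝ)) :
      BackExec inn w Δ (.traverse x y) s .abort 3
  | traverse_marked {x y : V} {s : BState V} (hx : x ≠ w)
      (hΔ : ((s.arcs + 1 : ℕ) : ℝ) < Δ) (hm : x ∈ s.marked) :
      BackExec inn w Δ (.traverse x y) s (.done { s with arcs := s.arcs + 1 }) 4
  | traverse_visit {x y : V} {s : BState V} {r : BResult V} {t : ℕ} (hx : x ≠ w)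
      (hΔ : ((s.arcs + 1 : ℕ) : ℝ) < Δ) (hm : x ∉ s.marked)
      (h : BackExec inn w Δ (.visit x) { s with arcs := s.arcs + 1 } r t) :
      BackExec inn w Δ (.traverse x y) s r (t + 4)

/-- Give `w` the level `k` and empty its set of incoming arcs. -/
def State.raise (s : State V) (w : V) (k : ℕ) : State V :=
  { s with level := Function.update s.level w k, inn := Function.update s.inn w ∅ }

/-- The possible results of the second step of an insertion: a cycle is reported, or the
forward search is skipped, or it follows from the given state; `B` is the list of vertices
handed on. -/
inductive SearchResult (V : Type*) where
  | cycle
  | skip (B : List V)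
  | forward (s : State V) (B : List V)

/-- The backward search for an arc `(v, w)` and what is done at its end. It starts with no
vertex marked. -/
inductive BackStep (Δ : ℝ) (s : State V) (v w : V) : SearchResult V → ℕ → Prop
  | cycle {t : ℕ} (h : BackExec s.inn w Δ (.visit v) ⟨∅, [], 0⟩ .cycle t) :
      BackStep Δ s v w .cycle (t + 3)
  | abort {t : ℕ} (h : BackExec s.inn w Δ (.visit v) ⟨∅, [], 0⟩ .abort t) :
      BackStep Δ s v w (.forward (s.raise w (s.level v + 1)) []) (t + 7)
  | same {b : BState V} {t : ℕ} (h : BackExec s.inn w Δ (.visit v) ⟨∅, [], 0⟩ (.done b) t)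
      (hk : s.level w = s.level v) :
      BackStep Δ s v w (.skip b.B) (t + 4)
  | differ {b : BState V} {t : ℕ} (h : BackExec s.inn w Δ (.visit v) ⟨∅, [], 0⟩ (.done b) t)
      (hk : s.level w ≠ s.level v) :
      BackStep Δ s v w (.forward (s.raise w (s.level v)) b.B) (t + 6)

/-! ### Forward search -/

/-- The procedures of the forward search; `loop x l` is what remains of the loop of `visit x`
when the arcs `(x, y)` with `y` in `l` are still to be traversed. -/
inductive FCall (V : Type*) where
  | visit (x : V)
  | loop (x : V) (l : List V)
  | traverse (x y : V)

/-- If `y` is on the level of `w`, add the arc `(x, y)` to the incoming arcs of `y`. -/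
def State.addIn (s : State V) (w x y : V) : State V :=
  if s.level y = s.level w then
    { s with inn := Function.update s.inn y (insert x (s.inn y)) }
  else s

/-- `ForwardExec v w B call s F r t`: during the insertion of the arc `(v, w)`, with list `B`
from the backward search, the call started in state `s` with list `F` can end after `t` units of
time with result `r`; here `r` is the new state and list, or `none` if a cycle is reported. -/
inductive ForwardExec (v w : V) (B : List V) :
    FCall V → State V → List V → Option (State V × List V) → ℕ → Prop
  | visit_done {x : V} {l F F' : List V} {s s' : State V} {t : ℕ} (hl : Enumerates l (s.out x))
      (h : ForwardExec v w B (.loop x l) s F (some (s', F')) t) :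
      ForwardExec v w B (.visit x) s F (some (s', x :: F')) (t + 1)
  | visit_cycle {x : V} {l F : List V} {s : State V} {t : ℕ} (hl : Enumerates l (s.out x))
      (h : ForwardExec v w B (.loop x l) s F none t) :
      ForwardExec v w B (.visit x) s F none t
  | loop_nil {x : V} {F : List V} {s : State V} :
      ForwardExec v w B (.loop x []) s F (some (s, F)) 1
  | loop_cons {x y : V} {l F F' : List V} {s s' : State V} {r : Option (State V × List V)}
      {t t' : ℕ} (h : ForwardExec v w B (.traverse x y) s F (some (s', F')) t)
      (h' : ForwardExec v w B (.loop x l) s' F' r t') :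
      ForwardExec v w B (.loop x (y :: l)) s F r (1 + t + t')
  | loop_cycle {x y : V} {l F : List V} {s : State V} {t : ℕ}
      (h : ForwardExec v w B (.traverse x y) s F none t) :
      ForwardExec v w B (.loop x (y :: l)) s F none (1 + t)
  | traverse_cycle {x y : V} {F : List V} {s : State V} (hy : y = v ∨ y ∈ B) :
      ForwardExec v w B (.traverse x y) s F none 2
  | traverse_raise {x y : V} {F F' : List V} {s s' : State V} {t : ℕ} (hy : ¬(y = v ∨ y ∈ B))
      (hk : s.level y < s.level w)
      (h : ForwardExec v w B (.visit y) (s.raise y (s.level w)) F (some (s', F')) t) :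
      ForwardExec v w B (.traverse x y) s F (some (s'.addIn w x y, F')) (t + 5)
  | traverse_raise_cycle {x y : V} {F : List V} {s : State V} {t : ℕ} (hy : ¬(y = v ∨ y ∈ B))
      (hk : s.level y < s.level w)
      (h : ForwardExec v w B (.visit y) (s.raise y (s.level w)) F none t) :
      ForwardExec v w B (.traverse x y) s F none (t + 4)
  | traverse_keep {x y : V} {F : List V} {s : State V} (hy : ¬(y = v ∨ y ∈ B))
      (hk : s.level w ≤ s.level y) :
      ForwardExec v w B (.traverse x y) s F (some (s.addIn w x y, F)) 3

/-! ### Re-indexing, insertion of the arc, and the whole algorithm -/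

/-- Decrease the smallest index by one and give it to `x`. -/
def State.reindexOne (s : State V) (x : V) : State V :=
  { s with low := s.low - 1, idx := Function.update s.idx x (s.low - 1) }

/-- Give new smallest indices to the vertices on `L`, from the last one to the first one. -/
def State.reindex (s : State V) (L : List V) : State V :=
  L.reverse.foldl State.reindexOne s

/-- Add the arc `(v, w)` to `out v` and, if its ends are on the same level, to `inn w`. -/
def State.addArc (s : State V) (v w : V) : State V :=
  { s with
    out := Function.update s.out v (insert w (s.out v))
    inn := if s.level v = s.level w then Function.update s.inn w (insert v (s.inn w)) else s.inn }

/-- The lexicographic order by level and index. -/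
def State.Before (s : State V) (v w : V) : Prop :=
  s.level v < s.level w ∨ s.level v = s.level w ∧ s.idx v < s.idx w

/-- `InsertArc Δ s v w r t`: inserting `(v, w)` in state `s` can take `t` units of time and
result in the state `r`, or in the report of a cycle if `r = none`. Re-indexing a list `L` takes
four units for each vertex on it and two for forming `L` and the last test; adding the arc takes
two. -/
inductive InsertArc (Δ : ℝ) (s : State V) (v w : V) : Option (State V) → ℕ → Prop
  | ordered (h : s.Before v w) : InsertArc Δ s v w (some (s.addArc v w)) 3
  | back_cycle {t : ℕ} (h : ¬s.Before v w) (hb : BackStep Δ s v w .cycle t) :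
      InsertArc Δ s v w none (1 + t)
  | skip {B : List V} {t : ℕ} (h : ¬s.Before v w) (hb : BackStep Δ s v w (.skip B) t) :
      InsertArc Δ s v w (some ((s.reindex B).addArc v w)) (1 + t + (4 * B.length + 2) + 2)
  | forward_cycle {s' : State V} {B : List V} {t t' : ℕ} (h : ¬s.Before v w)
      (hb : BackStep Δ s v w (.forward s' B) t)
      (hf : ForwardExec v w B (.visit w) s' [] none t') :
      InsertArc Δ s v w none (1 + t + t')
  | forward {s' s'' : State V} {B F : List V} {t t' : ℕ} (h : ¬s.Before v w)
      (hb : BackStep Δ s v w (.forward s' B) t)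
      (hf : ForwardExec v w B (.visit w) s' [] (some (s'', F)) t') :
      InsertArc Δ s v w (some ((s''.reindex (B ++ F)).addArc v w))
        (1 + t + t' + (4 * (B ++ F).length + 2) + 2)

/-- `Run Δ s l r t`: starting in state `s`, the algorithm can process the arcs of `l`, in this
order, in total time `t`. Here `r` is the final state, or `none` if the algorithm stopped and
reported a cycle. -/
inductive Run (Δ : ℝ) : State V → List (V × V) → Option (State V) → ℕ → Prop
  | nil {s : State V} : Run Δ s [] (some s) 0
  | cons {s s' : State V} {v w : V} {l : List (V × V)} {r : Option (State V)} {t t' : ℕ}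
      (h : InsertArc Δ s v w (some s') t) (h' : Run Δ s' l r t') :
      Run Δ s ((v, w) :: l) r (t + t')
  | reported {s : State V} {v w : V} {l : List (V × V)} {t : ℕ}
      (h : InsertArc Δ s v w none t) : Run Δ s ((v, w) :: l) none t

/-- The parameter `Δ` of the algorithm for `n` vertices and `m` arcs. -/
noncomputable def searchBound (n m : ℕ) : ℝ :=
  min ((m : ℝ) ^ (1 / 2 : ℝ)) ((n : ℝ) ^ (2 / 3 : ℝ))

/-- An admissible initial assignment of indices: distinct integers from `-n` to `-1`. -/
def IsInitialIndexing {n : ℕ} (i₀ : Fin n → ℤ) : Prop :=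
  Function.Injective i₀ ∧ ∀ v, -(n : ℤ) ≤ i₀ v ∧ i₀ v ≤ -1

/-- The initial state: no arcs, all vertices on level one. -/
def initState {n : ℕ} (i₀ : Fin n → ℤ) : State (Fin n) where
  level := fun _ => 1
  idx := i₀
  low := -(n : ℤ)
  out := fun _ => ∅
  inn := fun _ => ∅

/-- The arcs of the list form a directed acyclic graph; in particular there is no loop. -/
def IsAcyclicArcs (l : List (V × V)) : Prop :=
  ∀ x : V, ¬Relation.TransGen (fun a b => (a, b) ∈ l) x x

end SparseCycle

/-! The hard instance makes one dense set of vertices climb through about `Δ` levels. Cut the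
vertices, in the order of their initial indices, into `k` blocks of `s` vertices; the remaining
vertices have the largest indices, and `q` of them form the hub. Each block and the hub carry all
arcs that increase the index, and the first vertex of each block points to the whole hub. These core
arcs agree with the indices and cause no search.

Then, for `j = k - 1, …, 1`, the arc from the last vertex of block `j + 1` to the first vertex `w`
of block `j` is inserted. It goes against the current order. Block `j + 1` alone has at least `Δ`
arcs, so the backward search aborts and `w` is put one level above that block. The forward search
lifts block `j` and the hub to this level and traverses all `q(q - 1)/2` arcs of the hub. The next
chain arc lifts the hub again.

Up to constants, `s = √Δ`, `k = Δ` and `q = √m`, so the chain costs about `Δ · m`. The blocks use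
about `Δ^(3/2)` vertices and `Δ²` arcs; this fits because `Δ ≤ n^(2/3)` and `Δ ≤ m^(1/2)`. Further
arcs compatible with the final topological order bring the number to exactly `m`.

The orders of the loops do not matter, because the invariants concern only sets of arcs, levels and
counts. Re-indexing does not matter either: after the first chain arc all needed comparisons are
decided by levels. The argument is carried by `BackExec.eq_abort` (the search aborts),
`insertArc_abort` (effect and cost of such an insertion), `Layout.Stage.step` (one chain arc),
`Layout.exists_runsAtLeast` (the whole run) and `exists_parameters` (the sizes). -/

namespace SparseCycle

variable {V : Type*} [DecidableEq V]

/-! ### Backward search -/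

/-- The vertices that a call of the backward search reaches directly. -/
def BCall.vertices : BCall V → Finset V
  | .visit y => {y}
  | .loop _ l => l.toFinset
  | .traverse x _ => {x}

/-- The number of arcs that a call of the backward search traverses itself, not counting those
traversed by the visits it starts. -/
def BCall.pending : BCall V → ℕ
  | .visit _ => 0
  | .loop _ l => l.length
  | .traverse _ _ => 1

/-- What holds after a call of the backward search that ends normally. -/
structure BackDone (inn : V → Finset V) (Δ : ℝ) (c : BCall V) (s s' : BState V) : Prop where
  arcs_lt : (s.arcs : ℝ) < Δ → (s'.arcs : ℝ) < Δ
  marked_subset : s.marked ⊆ s'.marked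
  vertices_subset : c.vertices ⊆ s'.marked
  closed : ∀ z ∈ s'.marked, z ∉ s.marked → inn z ⊆ s'.marked
  arcs_ge : s.arcs + c.pending + ∑ z ∈ s'.marked \ s.marked, (inn z).card ≤ s'.arcs

/-- Each newly marked vertex has had its whole loop executed, so all its incoming arcs were counted
and all their tails marked, in whatever order. The counter stays below `Δ` because every traversal
tests it before continuing. -/
theorem BackExec.backDone {inn : V → Finset V} {w : V} {Δ : ℝ} {c : BCall V} {s : BState V}
    {r : BResult V} {t : ℕ} (h : BackExec inn w Δ c s r t) :
    ∀ s', r = .done s' → BackDone inn Δ c s s' := by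
  induction h with
  | @visit_done y l s s₁ t hl _ ih =>
    rintro _ ⟨⟩
    have I := ih _ rfl
    have hy : y ∈ s₁.marked := I.marked_subset (by simp)
    refine ⟨I.arcs_lt, fun z hz => I.marked_subset (by simp [hz]), by simpa [BCall.vertices],
      fun z hz hz' => ?_, ?_⟩
    · by_cases hzy : z = y
      · subst hzy
        have := I.vertices_subset
        simpa [BCall.vertices, hl.2] using this
      · exact I.closed z hz (by simp [hzy, hz'])
    · have h1 : l.length = (inn y).card := by rw [← hl.2, List.toFinset_card_of_nodup hl.1]
      have h2 : s₁.marked \ s.marked ⊆ insert y (s₁.marked \ insert y s.marked) := by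
        intro z; simp only [Finset.mem_sdiff, Finset.mem_insert]; tauto
      have h3 := I.arcs_ge
      simp only [BCall.pending] at h3 ⊢
      -- The in-degree of `y` is paid for by the pending arcs of its own loop, since `y` is already
      -- marked when that loop starts.
      have h4 : ∑ z ∈ s₁.marked \ s.marked, (inn z).card ≤
          ∑ z ∈ insert y (s₁.marked \ insert y s.marked), (inn z).card :=
        Finset.sum_le_sum_of_subset h2
      rw [Finset.sum_insert (by simp)] at h4
      omega
  | visit_abort => rintro _ ⟨⟩
  | visit_cycle => rintro _ ⟨⟩
  | loop_nil =>
    rintro _ ⟨⟩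
    exact ⟨id, subset_rfl, by simp [BCall.vertices], fun z h h' => absurd h h',
      by simp [BCall.pending]⟩
  | @loop_cons x y l s s₁ r t t' _ _ ih ih' =>
    intro s₂ hr
    have I := ih _ rfl
    have J := ih' _ hr
    refine ⟨fun h => J.arcs_lt (I.arcs_lt h), I.marked_subset.trans J.marked_subset, ?_,
      fun z hz hz' => ?_, ?_⟩
    · have h1 := I.vertices_subset.trans J.marked_subset
      have h2 := J.vertices_subset
      simp only [BCall.vertices, List.toFinset_cons, Finset.singleton_subset_iff] at h1 h2 ⊢
      exact Finset.insert_subset h1 h2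
    · by_cases h1 : z ∈ s₁.marked
      · exact (I.closed z h1 hz').trans J.marked_subset
      · exact J.closed z hz h1
    · have h1 := I.arcs_ge
      have h2 := J.arcs_ge
      have h3 : s₂.marked \ s.marked ⊆ (s₁.marked \ s.marked) ∪ (s₂.marked \ s₁.marked) := by
        intro z; simp only [Finset.mem_sdiff, Finset.mem_union]; tauto
      have h4 : ∑ z ∈ s₂.marked \ s.marked, (inn z).card ≤
          ∑ z ∈ (s₁.marked \ s.marked) ∪ (s₂.marked \ s₁.marked), (inn z).card :=
        Finset.sum_le_sum_of_subset h3
      rw [Finset.sum_union (by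
        rw [Finset.disjoint_left]; intro z; simp only [Finset.mem_sdiff]; tauto)] at h4
      simp only [BCall.pending, List.length_cons] at h1 h2 ⊢
      omega
  | loop_abort => rintro _ ⟨⟩
  | loop_cycle => rintro _ ⟨⟩
  | traverse_cycle => rintro _ ⟨⟩
  | traverse_abort => rintro _ ⟨⟩
  | traverse_marked hx hΔ hm =>
    rintro _ ⟨⟩
    exact ⟨fun _ => hΔ, subset_rfl, by simpa [BCall.vertices] using hm,
      fun z h h' => absurd h h', by simp [BCall.pending]⟩
  | traverse_visit hx hΔ hm _ ih =>
    intro s' hr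
    have I := ih _ hr
    exact ⟨fun _ => I.arcs_lt hΔ, I.marked_subset, I.vertices_subset, I.closed, I.arcs_ge⟩

/-- A search that starts outside `R` and follows arcs backward never enters `R`, hence never meets
`w`. -/
theorem BackExec.ne_cycle {inn : V → Finset V} {w : V} {Δ : ℝ} {R : Set V} (hw : w ∈ R)
    (hR : ∀ y ∉ R, ∀ x ∈ inn y, x ∉ R) {c : BCall V} {s : BState V} {r : BResult V} {t : ℕ}
    (h : BackExec inn w Δ c s r t) : (∀ x ∈ c.vertices, x ∉ R) → r ≠ .cycle := by
  induction h with
  | visit_done => rintro _ ⟨⟩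
  | visit_abort => rintro _ ⟨⟩
  | @visit_cycle y l s t hl _ ih =>
    intro hc _
    refine ih (fun x hx => hR y (hc y (by simp [BCall.vertices])) x ?_) rfl
    simpa [BCall.vertices, hl.2] using hx
  | loop_nil => rintro _ ⟨⟩
  | loop_cons _ _ _ ih' =>
    intro hc
    exact ih' fun x hx => hc x (by simp only [BCall.vertices, List.toFinset_cons] at hx ⊢; simp [hx])
  | loop_abort => rintro _ ⟨⟩
  | loop_cycle _ ih =>
    intro hc _
    exact ih (fun x hx => hc x (by simp only [BCall.vertices] at hx ⊢; simp_all)) rfl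
  | traverse_cycle hx =>
    intro hc _
    subst hx
    exact hc _ (by simp [BCall.vertices]) hw
  | traverse_abort => rintro _ ⟨⟩
  | traverse_marked => rintro _ ⟨⟩
  | traverse_visit _ _ _ _ ih => exact ih

/-- Termination: a nested visit marks a new vertex, so the outer induction is on the number of
unmarked vertices, the inner one on the list. This keeps statements about all executions from being
vacuous. -/
theorem BackExec.exists_loop [Fintype V] (inn : V → Finset V) (w : V) (Δ : ℝ) (N : ℕ) :
    ∀ (l : List V) (y : V) (s : BState V), s.markedᶜ.card ≤ N →
      ∃ r t, BackExec inn w Δ (.loop y l) s r t := by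
  induction N with
  | zero =>
    intro l y
    induction l with
    | nil => exact fun s _ => ⟨_, _, .loop_nil⟩
    | cons x l ih =>
      intro s hs
      have hm : x ∈ s.marked := by
        have : s.markedᶜ = ∅ := by simpa using hs
        by_contra hx
        have : x ∈ s.markedᶜ := by simpa using hx
        simp_all
      by_cases hx : x = w
      · exact ⟨_, _, .loop_cycle (.traverse_cycle hx)⟩
      rcases le_or_gt Δ ((s.arcs + 1 : ℕ) : ℝ) with hΔ | hΔ
      · exact ⟨_, _, .loop_abort (.traverse_abort hx hΔ)⟩
      obtain ⟨r, t, h⟩ := ih { s with arcs := s.arcs + 1 } hs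
      exact ⟨_, _, .loop_cons (.traverse_marked hx hΔ hm) h⟩
  | succ N IH =>
    intro l y
    induction l with
    | nil => exact fun s _ => ⟨_, _, .loop_nil⟩
    | cons x l ih =>
      intro s hs
      by_cases hx : x = w
      · exact ⟨_, _, .loop_cycle (.traverse_cycle hx)⟩
      rcases le_or_gt Δ ((s.arcs + 1 : ℕ) : ℝ) with hΔ | hΔ
      · exact ⟨_, _, .loop_abort (.traverse_abort hx hΔ)⟩
      by_cases hm : x ∈ s.marked
      · obtain ⟨r, t, h⟩ := ih { s with arcs := s.arcs + 1 } hs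
        exact ⟨_, _, .loop_cons (.traverse_marked hx hΔ hm) h⟩
      have hl : Enumerates (inn x).toList (inn x) := ⟨Finset.nodup_toList _, by simp⟩
      obtain ⟨r, t, h⟩ := IH (inn x).toList x
        { marked := insert x s.marked, B := s.B, arcs := s.arcs + 1 } (by
          have : (insert x s.marked)ᶜ = s.markedᶜ.erase x := by
            ext z; simp
          rw [this, Finset.card_erase_of_mem (by simpa using hm)]
          omega)
      cases r with
      | cycle => exact ⟨_, _, .loop_cycle (.traverse_visit hx hΔ hm (.visit_cycle hl h))⟩
      | abort => exact ⟨_, _, .loop_abort (.traverse_visit hx hΔ hm (.visit_abort hl h))⟩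
      | done s' =>
        have h1 := (h.backDone _ rfl).marked_subset
        obtain ⟨r, t', h'⟩ := ih { s' with B := s'.B ++ [x] } (by
          refine (Finset.card_le_card (Finset.compl_subset_compl.2 ?_)).trans hs
          exact (Finset.subset_insert _ _).trans h1)
        exact ⟨_, _, .loop_cons (.traverse_visit hx hΔ hm (.visit_done hl h)) h'⟩

theorem BackExec.exists_visit [Fintype V] (inn : V → Finset V) (w : V) (Δ : ℝ) (y : V)
    (s : BState V) : ∃ r t, BackExec inn w Δ (.visit y) s r t := by
  have hl : Enumerates (inn y).toList (inn y) := ⟨Finset.nodup_toList _, by simp⟩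
  obtain ⟨r, t, h⟩ := BackExec.exists_loop inn w Δ _ (inn y).toList y
    { s with marked := insert y s.marked } le_rfl
  cases r with
  | cycle => exact ⟨_, _, .visit_cycle hl h⟩
  | abort => exact ⟨_, _, .visit_abort hl h⟩
  | done s' => exact ⟨_, _, .visit_done hl h⟩

/-- A backward search from `v` is aborted, whatever the order of its loops, if it cannot reach
`w` and if `v` and its direct predecessors have `Δ` incoming arcs. -/
theorem BackExec.eq_abort {inn : V → Finset V} {v w : V} {Δ : ℝ} {R : Set V} (hw : w ∈ R)
    (hv : v ∉ R) (hR : ∀ y ∉ R, ∀ x ∈ inn y, x ∉ R) (hpos : 0 < Δ)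
    (hΔ : Δ ≤ ((∑ z ∈ insert v (inn v), (inn z).card : ℕ) : ℝ)) {r : BResult V} {t : ℕ}
    (h : BackExec inn w Δ (.visit v) ⟨∅, [], 0⟩ r t) : r = .abort := by
  cases r with
  | abort => rfl
  | cycle => exact absurd rfl (h.ne_cycle hw hR (by simpa [BCall.vertices]))
  | done s' =>
    have I := h.backDone _ rfl
    have hvm : v ∈ s'.marked := I.vertices_subset (by simp [BCall.vertices])
    have h1 : insert v (inn v) ⊆ s'.marked :=
      Finset.insert_subset hvm (I.closed v hvm (by simp))
    have h2 := I.arcs_ge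
    have h3 : ∑ z ∈ insert v (inn v), (inn z).card ≤ ∑ z ∈ s'.marked, (inn z).card :=
      Finset.sum_le_sum_of_subset h1
    simp only [BCall.pending, Finset.sdiff_empty] at h2
    have h4 := I.arcs_lt (by simpa using hpos)
    have h5 : ((∑ z ∈ insert v (inn v), (inn z).card : ℕ) : ℝ) ≤ s'.arcs := by
      exact_mod_cast (by omega)
    linarith

/-! ### Forward search -/

/-- The arcs that a call of the forward search traverses itself, not counting those traversed by
the visits it starts; `out` are the outgoing arcs. -/
def FCall.Arc (out : V → Finset V) : FCall V → V → V → Prop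
  | .visit x, a, b => a = x ∧ b ∈ out x
  | .loop x l, a, b => a = x ∧ b ∈ l
  | .traverse x y, a, b => a = x ∧ b = y

/-- The number of arcs that a call of the forward search traverses itself. -/
def FCall.pending (out : V → Finset V) : FCall V → ℕ
  | .visit x => (out x).card
  | .loop _ l => l.length
  | .traverse _ _ => 1

/-- The vertices raised to the level `K` between two states. -/
def raisedTo [Fintype V] (K : ℕ) (s s' : State V) : Finset V :=
  Finset.univ.filter fun x => s.level x < K ∧ s'.level x = K

/-- What holds after a call of the forward search that does not report a cycle. -/
structure ForwardDone [Fintype V] (K : ℕ) (c : FCall V) (s s' : State V) (t : ℕ) : Prop where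
  out_eq : s'.out = s.out
  level_eq : ∀ y, s'.level y = s.level y ∨ s.level y < K ∧ s'.level y = K
  inn_mono : ∀ y, K ≤ s.level y → s.inn y ⊆ s'.inn y
  arc_spec : ∀ x z, c.Arc s.out x z ∨ x ∈ raisedTo K s s' ∧ z ∈ s.out x →
    K ≤ s'.level z ∧ (s'.level z = K → x ∈ s'.inn z)
  inn_sub : ∀ x y, x ∈ s'.inn y → x ∈ s.inn y ∨ y ∈ s.out x ∨ c.Arc s.out x y
  time_ge : c.pending s.out + ∑ x ∈ raisedTo K s s', (s.out x).card ≤ t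
  unchanged : ∀ R : Set V, (∀ x ∈ R, ∀ y ∈ s.out x, y ∈ R) → (∀ x y, c.Arc s.out x y → y ∈ R) →
    ∀ y ∉ R, s'.level y = s.level y

/-- During the search a vertex is either left alone or raised once, from below `K` to `K`, and each
raised vertex is visited and pays its out-degree. Keeping `inn_mono` in the invariant is what makes
`arc_spec` survive later traversals. -/
theorem ForwardExec.forwardDone [Fintype V] {v w : V} {B : List V} {c : FCall V} {s : State V}
    {F : List V} {r : Option (State V × List V)} {t : ℕ} (h : ForwardExec v w B c s F r t) :
    ∀ s' F', r = some (s', F') → ForwardDone (s.level w) c s s' t := by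
  induction h with
  | @visit_done x l F F₁ s s₁ t hl _ ih =>
    rintro _ _ ⟨⟩
    have I := ih _ _ rfl
    have hm : ∀ z, z ∈ s.out x ↔ z ∈ l := fun z => by rw [← hl.2, List.mem_toFinset]
    have hc : (s.out x).card = l.length := by rw [← hl.2, List.toFinset_card_of_nodup hl.1]
    have hA : ∀ a b, (FCall.visit x).Arc s.out a b ↔ (FCall.loop x l).Arc s.out a b :=
      fun a b => by simp [FCall.Arc, hm]
    refine ⟨I.out_eq, I.level_eq, I.inn_mono, ?_, ?_, ?_, ?_⟩
    · simpa only [hA] using I.arc_spec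
    · simpa only [hA] using I.inn_sub
    · have := I.time_ge
      simp only [FCall.pending] at this ⊢
      omega
    · simpa only [hA] using I.unchanged
  | visit_cycle => rintro _ _ ⟨⟩
  | @loop_nil x F s =>
    rintro _ _ ⟨⟩
    have h0 : raisedTo (s.level w) s s = ∅ := by
      ext z; simp only [raisedTo, Finset.mem_filter]; simp; omega
    refine ⟨rfl, fun _ => .inl rfl, fun _ _ => subset_rfl, ?_, fun _ _ h => .inl h, ?_,
      fun _ _ _ _ _ => rfl⟩
    · rintro a b (h | h)
      · simp [FCall.Arc] at h
      · simp [h0] at h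
    · simp [h0, FCall.pending]
  | @loop_cons x y l F F₁ s s₁ r t t' _ _ ih ih' =>
    rintro s₂ F₂ hr
    have I := ih _ _ rfl
    have J := ih' _ _ hr
    have hK : s₁.level w = s.level w := by
      rcases I.level_eq w with h | h
      · exact h
      · exact absurd h.1 (lt_irrefl _)
    rw [hK] at J
    set K := s.level w with hKdef
    have hsub : raisedTo K s s₂ ⊆ raisedTo K s s₁ ∪ raisedTo K s₁ s₂ := by
      intro z
      have h1 := I.level_eq z
      have h2 := J.level_eq z
      simp only [raisedTo, Finset.mem_union, Finset.mem_filter, Finset.mem_univ, true_and]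
      omega
    -- A vertex on level `K` or higher is not raised again, so its incoming set is no longer
    -- emptied.
    have keep : ∀ x z, K ≤ s₁.level z ∧ (s₁.level z = K → x ∈ s₁.inn z) →
        K ≤ s₂.level z ∧ (s₂.level z = K → x ∈ s₂.inn z) := by
      rintro a z ⟨h1, h2⟩
      have h3 : s₂.level z = s₁.level z := by
        rcases J.level_eq z with h | h
        · exact h
        · omega
      exact ⟨h3 ▸ h1, fun h => J.inn_mono z h1 (h2 (h3 ▸ h))⟩
    have hA : ∀ a b, (FCall.loop x (y :: l)).Arc s.out a b ↔
        (FCall.traverse x y).Arc s.out a b ∨ (FCall.loop x l).Arc s₁.out a b :=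
      fun a b => by simp only [FCall.Arc, List.mem_cons]; tauto
    refine ⟨J.out_eq.trans I.out_eq, fun z => ?_, fun z hz => ?_, ?_, fun a z hz => ?_, ?_,
      fun R hR hc z hz => ?_⟩
    · have h1 := I.level_eq z
      have h2 := J.level_eq z
      omega
    · refine (I.inn_mono z hz).trans (J.inn_mono z ?_)
      have h1 := I.level_eq z
      omega
    · rintro a z (h | ⟨h, hz⟩)
      · rcases (hA _ _).1 h with h | h
        · exact keep _ _ (I.arc_spec _ _ (.inl h))
        · exact J.arc_spec _ _ (.inl h)
      · rcases Finset.mem_union.1 (hsub h) with h | h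
        · exact keep _ _ (I.arc_spec _ _ (.inr ⟨h, hz⟩))
        · exact J.arc_spec _ _ (.inr ⟨h, by rwa [I.out_eq]⟩)
    · rw [hA]
      rcases J.inn_sub a z hz with h | h | h
      · have := I.inn_sub a z h
        tauto
      · rw [I.out_eq] at h
        exact .inr (.inl h)
      · exact .inr (.inr (.inr h))
    · have h1 := I.time_ge
      have h2 := J.time_ge
      have h3 : ∑ z ∈ raisedTo K s s₂, (s.out z).card ≤
          ∑ z ∈ raisedTo K s s₁ ∪ raisedTo K s₁ s₂, (s.out z).card :=
        Finset.sum_le_sum_of_subset hsub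
      have h4 : ∑ z ∈ raisedTo K s s₁ ∪ raisedTo K s₁ s₂, (s.out z).card ≤
          ∑ z ∈ raisedTo K s s₁, (s.out z).card + ∑ z ∈ raisedTo K s₁ s₂, (s.out z).card := by
        rw [← Finset.sum_union_inter]
        exact Nat.le_add_right _ _
      rw [I.out_eq] at h2
      simp only [FCall.pending, List.length_cons] at h1 h2 ⊢
      omega
    · have h1 := I.unchanged R hR (fun a b h => hc a b ((hA _ _).2 (.inl h))) z hz
      have h2 := J.unchanged R (by rwa [I.out_eq])
        (fun a b h => hc a b ((hA _ _).2 (.inr h))) z hz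
      exact h2.trans h1
  | loop_cycle => rintro _ _ ⟨⟩
  | traverse_cycle => rintro _ _ ⟨⟩
  | @traverse_raise x y F F₁ s s₁ t hy hk _ ih =>
    rintro _ _ ⟨⟩
    have hyw : w ≠ y := by rintro rfl; exact lt_irrefl _ hk
    have hKw : (s.raise y (s.level w)).level w = s.level w := by
      simp [State.raise, hyw]
    have I := ih _ _ rfl
    rw [hKw] at I
    have hly : (s.raise y (s.level w)).level y = s.level w := by simp [State.raise]
    have hlz : ∀ z, z ≠ y → (s.raise y (s.level w)).level z = s.level z := fun z hz => by
      simp [State.raise, hz]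
    have hiz : ∀ z, z ≠ y → (s.raise y (s.level w)).inn z = s.inn z := fun z hz => by
      simp [State.raise, hz]
    have hiy : (s.raise y (s.level w)).inn y = ∅ := by simp [State.raise]
    have ho : (s.raise y (s.level w)).out = s.out := rfl
    set K := s.level w with hKdef
    set s₀ := s.raise y K with hs₀
    have h1y : s₁.level y = K := by
      have := I.level_eq y
      omega
    have h1w : s₁.level w = K := by
      have := I.level_eq w
      omega
    have hadd : s₁.addIn w x y =
        { s₁ with inn := Function.update s₁.inn y (insert x (s₁.inn y)) } := by
      simp [State.addIn, h1y, h1w]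
    rw [hadd]
    have hi : ∀ z, s₁.inn z ⊆ Function.update s₁.inn y (insert x (s₁.inn y)) z := by
      intro z
      by_cases hz : z = y
      · subst hz; simp
      · simp [hz]
    have hlev : ∀ z, s₁.level z = s.level z ∨ s.level z < K ∧ s₁.level z = K := by
      intro z
      by_cases hz : z = y
      · subst hz; exact .inr ⟨hk, h1y⟩
      · rw [← hlz z hz]; exact I.level_eq z
    have hr : ∀ z, s.level z < K → s₁.level z = K → z = y ∨ z ∈ raisedTo K s₀ s₁ := by
      intro z h1 h2
      by_cases hz : z = y
      · exact .inl hz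
      · right
        simp only [raisedTo, Finset.mem_filter, Finset.mem_univ, true_and]
        exact ⟨by rwa [hlz z hz], h2⟩
    refine ⟨I.out_eq, hlev, fun z hz => ?_, ?_, fun a z hz => ?_, ?_, fun R hR hc z hz => ?_⟩
    · have hzy : z ≠ y := by rintro rfl; omega
      refine subset_trans ?_ (hi z)
      rw [← hiz z hzy]
      exact I.inn_mono z (by rwa [hlz z hzy])
    · have key : ∀ a z, K ≤ s₁.level z ∧ (s₁.level z = K → a ∈ s₁.inn z) →
          K ≤ s₁.level z ∧ (s₁.level z = K →
            a ∈ Function.update s₁.inn y (insert x (s₁.inn y)) z) :=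
        fun a z h => ⟨h.1, fun h' => hi z (h.2 h')⟩
      rintro a z (⟨rfl, rfl⟩ | ⟨h, hz⟩)
      · exact ⟨h1y.ge, fun _ => by simp⟩
      · simp only [raisedTo, Finset.mem_filter, Finset.mem_univ, true_and] at h
        rcases hr a h.1 h.2 with rfl | h
        · exact key _ _ (I.arc_spec _ _ (.inl ⟨rfl, hz⟩))
        · exact key _ _ (I.arc_spec _ _ (.inr ⟨h, hz⟩))
    · have key : a ∈ s₁.inn z → a ∈ s.inn z ∨ z ∈ s.out a := by
        intro h
        rcases I.inn_sub a z h with h | h | h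
        · by_cases hzy : z = y
          · subst hzy; rw [hiy] at h; simp at h
          · rw [hiz z hzy] at h; exact .inl h
        · exact .inr h
        · obtain ⟨rfl, h⟩ := h
          exact .inr h
      by_cases hzy : z = y
      · subst hzy
        simp only [Function.update_self, Finset.mem_insert] at hz
        rcases hz with rfl | hz
        · exact .inr (.inr ⟨rfl, rfl⟩)
        · have := key hz; tauto
      · simp only [Function.update_of_ne hzy] at hz
        have := key hz; tauto
    · have h1 := I.time_ge
      have h2 : raisedTo K s { s₁ with inn := Function.update s₁.inn y (insert x (s₁.inn y)) } ⊆
          insert y (raisedTo K s₀ s₁) := by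
        intro z hz
        simp only [raisedTo, Finset.mem_filter, Finset.mem_univ, true_and] at hz
        exact Finset.mem_insert.2 (hr z hz.1 hz.2)
      have h3 := Finset.sum_le_sum_of_subset (f := fun z => (s.out z).card) h2
      -- `y` is already on level `K` when its visit starts. Its out-degree is therefore the pending
      -- count of the visit and is not counted twice.
      have h4 : y ∉ raisedTo K s₀ s₁ := by
        simp only [raisedTo, Finset.mem_filter, Finset.mem_univ, true_and]
        omega
      rw [Finset.sum_insert h4] at h3
      simp only [FCall.pending, ho] at h1 ⊢
      omega
    · have hyR : y ∈ R := hc x y ⟨rfl, rfl⟩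
      have h1 := I.unchanged R hR (fun a b h => by
        obtain ⟨rfl, h⟩ := h
        exact hR _ hyR _ h) z hz
      exact h1.trans (hlz z (by rintro rfl; exact hz hyR))
  | traverse_raise_cycle => rintro _ _ ⟨⟩
  | @traverse_keep x y F s hy hk =>
    rintro _ _ ⟨⟩
    have h1 : (s.addIn w x y).level = s.level := by simp only [State.addIn]; split <;> rfl
    have h2 : (s.addIn w x y).out = s.out := by simp only [State.addIn]; split <;> rfl
    have h3 : ∀ z, s.inn z ⊆ (s.addIn w x y).inn z := by
      intro z
      simp only [State.addIn]
      split
      · by_cases hz : z = y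
        · subst hz; simp
        · simp [hz]
      · exact subset_rfl
    have h0 : raisedTo (s.level w) s (s.addIn w x y) = ∅ := by
      ext z; simp only [raisedTo, Finset.mem_filter, h1]; simp; omega
    refine ⟨h2, fun z => .inl (by rw [h1]), fun z _ => h3 z, ?_, fun a z hz => ?_, ?_,
      fun _ _ _ z _ => by rw [h1]⟩
    · rintro a z (⟨rfl, rfl⟩ | h)
      · rw [h1]
        exact ⟨hk, fun h => by simp [State.addIn, h]⟩
      · simp [h0] at h
    · simp only [State.addIn] at hz
      split at hz
      · by_cases hzy : z = y
        · subst hzy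
          simp only [Function.update_self, Finset.mem_insert] at hz
          rcases hz with rfl | hz
          · exact .inr (.inr ⟨rfl, rfl⟩)
          · exact .inl hz
        · simp only [Function.update_of_ne hzy] at hz
          exact .inl hz
      · exact .inl hz
    · simp [h0, FCall.pending]

/-- With `B` empty, as it is after an abort, a cycle is reported only on meeting `v`, and the search
never leaves the closed set `R`. -/
theorem ForwardExec.ne_none [Fintype V] {v w : V} {R : Set V} (hv : v ∉ R) {c : FCall V}
    {s : State V} {F : List V} {r : Option (State V × List V)} {t : ℕ}
    (h : ForwardExec v w [] c s F r t) : (∀ x ∈ R, ∀ y ∈ s.out x, y ∈ R) →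
      (∀ x y, c.Arc s.out x y → y ∈ R) → r ≠ none := by
  generalize hB : ([] : List V) = B at h
  induction h with
  | visit_done => rintro _ _ ⟨⟩
  | visit_cycle hl _ ih =>
    intro hR hc _
    refine ih hR ?_ rfl
    rintro a b ⟨rfl, h⟩
    refine hc _ b ⟨rfl, ?_⟩
    rw [← hl.2]
    simpa using h
  | loop_nil => rintro _ _ ⟨⟩
  | loop_cons h _ _ ih' =>
    intro hR hc
    have ho := (h.forwardDone _ _ rfl).out_eq
    refine ih' (by rwa [ho]) ?_
    rintro a b ⟨rfl, hb⟩
    exact hc _ b ⟨rfl, List.mem_cons_of_mem _ hb⟩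
  | loop_cycle _ ih =>
    intro hR hc _
    refine ih hR ?_ rfl
    rintro a b ⟨rfl, rfl⟩
    exact hc _ _ ⟨rfl, List.mem_cons_self⟩
  | traverse_cycle hy =>
    subst hB
    intro _ hc _
    have := hc _ _ ⟨rfl, rfl⟩
    rcases hy with rfl | hy
    · exact hv this
    · simp at hy
  | traverse_raise => rintro _ _ ⟨⟩
  | traverse_raise_cycle _ _ _ ih =>
    intro hR hc _
    refine ih hR ?_ rfl
    rintro a b ⟨rfl, h⟩
    exact hR _ (hc _ _ ⟨rfl, rfl⟩) _ h
  | traverse_keep => rintro _ _ ⟨⟩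

/-- The vertices below the level `K`. -/
def lowerVertices [Fintype V] (K : ℕ) (s : State V) : Finset V :=
  Finset.univ.filter fun x => s.level x < K

/-- Termination: a nested visit is preceded by raising a vertex to the level of `w`, which lowers
the number of vertices below that level. -/
theorem ForwardExec.exists_loop [Fintype V] (v w : V) (B : List V) (N : ℕ) :
    ∀ (l : List V) (x : V) (s : State V) (F : List V), (lowerVertices (s.level w) s).card ≤ N →
      ∃ r t, ForwardExec v w B (.loop x l) s F r t := by
  induction N with
  | zero =>
    intro l x
    induction l with
    | nil => exact fun s F _ => ⟨_, _, .loop_nil⟩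
    | cons y l ih =>
      intro s F hs
      by_cases hy : y = v ∨ y ∈ B
      · exact ⟨_, _, .loop_cycle (.traverse_cycle hy)⟩
      have hk : s.level w ≤ s.level y := by
        by_contra hk
        have h1 : y ∈ lowerVertices (s.level w) s := by simpa [lowerVertices] using hk
        have h2 : lowerVertices (s.level w) s = ∅ := by simpa using hs
        simp [h2] at h1
      have h1 : (s.addIn w x y).level = s.level := by simp only [State.addIn]; split <;> rfl
      obtain ⟨r, t, h⟩ := ih (s.addIn w x y) F (by simpa only [lowerVertices, h1] using hs)
      exact ⟨_, _, .loop_cons (.traverse_keep hy hk) h⟩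
  | succ N IH =>
    intro l x
    induction l with
    | nil => exact fun s F _ => ⟨_, _, .loop_nil⟩
    | cons y l ih =>
      intro s F hs
      by_cases hy : y = v ∨ y ∈ B
      · exact ⟨_, _, .loop_cycle (.traverse_cycle hy)⟩
      rcases le_or_gt (s.level w) (s.level y) with hk | hk
      · have h1 : (s.addIn w x y).level = s.level := by simp only [State.addIn]; split <;> rfl
        obtain ⟨r, t, h⟩ := ih (s.addIn w x y) F (by simpa only [lowerVertices, h1] using hs)
        exact ⟨_, _, .loop_cons (.traverse_keep hy hk) h⟩
      have hl : Enumerates ((s.raise y (s.level w)).out y).toList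
        ((s.raise y (s.level w)).out y) := ⟨Finset.nodup_toList _, by simp⟩
      have hyw : w ≠ y := by rintro rfl; exact lt_irrefl _ hk
      have hKw : (s.raise y (s.level w)).level w = s.level w := by simp [State.raise, hyw]
      have hlt : (lowerVertices (s.level w) (s.raise y (s.level w))).card ≤ N := by
        have : lowerVertices (s.level w) (s.raise y (s.level w)) = (lowerVertices (s.level w) s).erase y := by
          ext z
          simp only [lowerVertices, Finset.mem_erase, Finset.mem_filter, Finset.mem_univ, true_and]
          by_cases hz : z = y
          · subst hz; simp [State.raise]
          · simp [State.raise, hz]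
        rw [this, Finset.card_erase_of_mem (by simpa [lowerVertices] using hk)]
        omega
      obtain ⟨r, t, h⟩ :=
        IH ((s.raise y (s.level w)).out y).toList y (s.raise y (s.level w)) F (by rwa [hKw])
      match r, h with
      | none, h =>
        exact ⟨_, _, .loop_cycle (.traverse_raise_cycle hy hk (.visit_cycle hl h))⟩
      | some (s', F'), h =>
        have hex := ForwardExec.traverse_raise (x := x) hy hk (.visit_done hl h)
        have I := hex.forwardDone _ _ rfl
        obtain ⟨r, t', h'⟩ := ih (s'.addIn w x y) (y :: F') (by
          refine (Finset.card_le_card fun z hz => ?_).trans hs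
          have h1 := I.level_eq w
          have h2 := I.level_eq z
          simp only [lowerVertices, Finset.mem_filter, Finset.mem_univ, true_and] at hz ⊢
          omega)
        exact ⟨_, _, .loop_cons hex h'⟩

theorem ForwardExec.exists_visit [Fintype V] (v w : V) (B : List V) (x : V) (s : State V)
    (F : List V) : ∃ r t, ForwardExec v w B (.visit x) s F r t := by
  have hl : Enumerates (s.out x).toList (s.out x) := ⟨Finset.nodup_toList _, by simp⟩
  obtain ⟨r, t, h⟩ := ForwardExec.exists_loop v w B _ (s.out x).toList x s F le_rfl
  match r, h with
  | none, h => exact ⟨_, _, .visit_cycle hl h⟩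
  | some (s', F'), h => exact ⟨_, _, .visit_done hl h⟩

/-! ### Runs -/

/-- The algorithm can process the arcs of `l`, starting in `s`, and every way to do so reports no
cycle and takes at least `T` units of time. -/
def RunsAtLeast (Δ : ℝ) (s : State V) (l : List (V × V)) (T : ℕ) : Prop :=
  (∃ r t, Run Δ s l r t) ∧ ∀ r t, Run Δ s l r t → r ≠ none ∧ T ≤ t

theorem RunsAtLeast.nil (Δ : ℝ) (s : State V) : RunsAtLeast Δ s [] 0 :=
  ⟨⟨_, _, .nil⟩, fun _ _ h => by cases h; exact ⟨by simp, le_rfl⟩⟩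

theorem RunsAtLeast.cons {Δ : ℝ} {s : State V} {v w : V} {l : List (V × V)} {T T' : ℕ}
    (hex : ∃ r t, InsertArc Δ s v w r t)
    (h : ∀ r t, InsertArc Δ s v w r t → ∃ s', r = some s' ∧ T ≤ t ∧ RunsAtLeast Δ s' l T') :
    RunsAtLeast Δ s ((v, w) :: l) (T + T') := by
  constructor
  · obtain ⟨r, t, hi⟩ := hex
    obtain ⟨s', rfl, -, ⟨r', t', h'⟩, -⟩ := h r t hi
    exact ⟨_, _, .cons hi h'⟩
  · intro r t hr
    cases hr with
    | cons hi h' =>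
      obtain ⟨s', hs, ht, -, hG⟩ := h _ _ hi
      cases hs
      have := hG _ _ h'
      exact ⟨this.1, by omega⟩
    | reported hi =>
      obtain ⟨s', hs, -⟩ := h _ _ hi
      cases hs

theorem RunsAtLeast.mono {Δ : ℝ} {s : State V} {l : List (V × V)} {T T' : ℕ}
    (h : RunsAtLeast Δ s l T) (hT : T' ≤ T) : RunsAtLeast Δ s l T' :=
  ⟨h.1, fun r t hr => ⟨(h.2 r t hr).1, hT.trans (h.2 r t hr).2⟩⟩

theorem RunsAtLeast.cons_ordered {Δ : ℝ} {s : State V} {v w : V} {l : List (V × V)} {T : ℕ}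
    (hs : s.Before v w) (h : RunsAtLeast Δ (s.addArc v w) l T) :
    RunsAtLeast Δ s ((v, w) :: l) (1 + T) := by
  refine .cons ⟨_, _, .ordered hs⟩ fun r t hi => ?_
  cases hi with
  | ordered _ => exact ⟨_, rfl, by omega, h⟩
  | back_cycle h' => exact absurd hs h'
  | skip h' => exact absurd hs h'
  | forward_cycle h' => exact absurd hs h'
  | forward h' => exact absurd hs h'

/-- Add the arcs of a list. -/
def State.addArcs (s : State V) (l : List (V × V)) : State V :=
  l.foldl (fun s a => s.addArc a.1 a.2) s

theorem State.addArcs_level (l : List (V × V)) (s : State V) :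
    (s.addArcs l).level = s.level := by
  induction l generalizing s with
  | nil => rfl
  | cons a l ih => exact ih _

theorem State.addArcs_idx (l : List (V × V)) (s : State V) : (s.addArcs l).idx = s.idx := by
  induction l generalizing s with
  | nil => rfl
  | cons a l ih => exact ih _

theorem State.mem_addArc_out (s : State V) (v w x y : V) :
    y ∈ (s.addArc v w).out x ↔ y ∈ s.out x ∨ (x, y) = (v, w) := by
  by_cases hx : x = v
  · subst hx; simp [State.addArc, or_comm]
  · simp [State.addArc, hx]

theorem State.mem_addArc_inn (s : State V) (v w x y : V) :
    x ∈ (s.addArc v w).inn y ↔ x ∈ s.inn y ∨ (x, y) = (v, w) ∧ s.level v = s.level w := by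
  by_cases h : s.level v = s.level w
  · by_cases hy : y = w
    · subst hy; simp [State.addArc, h, or_comm]
    · simp [State.addArc, h, hy]
  · simp [State.addArc, h]

theorem State.mem_addArcs_out (l : List (V × V)) (s : State V) (x y : V) :
    y ∈ (s.addArcs l).out x ↔ y ∈ s.out x ∨ (x, y) ∈ l := by
  induction l generalizing s with
  | nil => simp [State.addArcs]
  | cons a l ih =>
    have : s.addArcs (a :: l) = (s.addArc a.1 a.2).addArcs l := rfl
    rw [this, ih, State.mem_addArc_out, List.mem_cons, or_assoc]

theorem State.mem_addArcs_inn (l : List (V × V)) (s : State V) (x y : V) :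
    x ∈ (s.addArcs l).inn y ↔ x ∈ s.inn y ∨ (x, y) ∈ l ∧ s.level x = s.level y := by
  induction l generalizing s with
  | nil => simp [State.addArcs]
  | cons a l ih =>
    have h1 : s.addArcs (a :: l) = (s.addArc a.1 a.2).addArcs l := rfl
    have h2 : (s.addArc a.1 a.2).level = s.level := rfl
    rw [h1, ih, State.mem_addArc_inn, List.mem_cons, h2]
    constructor
    · rintro ((h | ⟨h, h'⟩) | h)
      · exact .inl h
      · cases h; exact .inr ⟨.inl rfl, h'⟩
      · exact .inr ⟨.inr h.1, h.2⟩
    · rintro (h | ⟨h | h, h'⟩)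
      · exact .inl (.inl h)
      · cases h; exact .inl (.inr ⟨rfl, h'⟩)
      · exact .inr ⟨h, h'⟩

/-- Arcs that agree with the order change neither levels nor indices, so testing all of them in the
starting state is enough. -/
theorem RunsAtLeast.append_ordered {Δ : ℝ} {l' : List (V × V)} {T : ℕ} (l : List (V × V))
    (s : State V) (hl : ∀ a ∈ l, s.Before a.1 a.2) (h : RunsAtLeast Δ (s.addArcs l) l' T) :
    RunsAtLeast Δ s (l ++ l') (l.length + T) := by
  induction l generalizing s with
  | nil => simpa [State.addArcs] using h
  | cons a l ih =>
    have := RunsAtLeast.cons_ordered (hl a (by simp))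
      (ih (s.addArc a.1 a.2) (fun b hb => hl b (by simp [hb])) h)
    refine this.mono ?_
    simp only [List.length_cons]
    omega

theorem State.reindex_eq (L : List V) (s : State V) :
    (s.reindex L).level = s.level ∧ (s.reindex L).out = s.out ∧ (s.reindex L).inn = s.inn := by
  unfold State.reindex
  generalize L.reverse = L
  induction L generalizing s with
  | nil => exact ⟨rfl, rfl, rfl⟩
  | cons x L ih => exact ih _

/-! ### Insertions whose backward search is aborted -/

/-- The state after the insertion of an arc `(v, w)` whose backward search has been aborted. -/
structure AfterRaise [Fintype V] (s : State V) (v w : V) (s' : State V) (t : ℕ) : Prop where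
  mem_out : ∀ x y, y ∈ s'.out x ↔ y ∈ s.out x ∨ (x, y) = (v, w)
  level_head : s'.level w = s.level v + 1
  level_eq : ∀ y, y ≠ w → s'.level y = s.level y ∨
    s.level y < s.level v + 1 ∧ s'.level y = s.level v + 1
  le_level : ∀ x z, x = w ∨ s.level x < s.level v + 1 ∧ s'.level x = s.level v + 1 →
    z ∈ s.out x → s.level v + 1 ≤ s'.level z ∧ (s'.level z = s.level v + 1 → x ∈ s'.inn z)
  mem_out_of_mem_inn : ∀ x y, x ∈ s'.inn y → y ∈ s'.out x
  time_ge : ∀ A : Finset V, w ∉ A →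
    (∀ x ∈ A, s.level x < s.level v + 1 ∧ s'.level x = s.level v + 1) →
      1 + ∑ x ∈ A, (s.out x).card ≤ t

/-- An arc `(v, w)` whose backward search is aborted raises the level of `w` above that of `v`.
No cycle is reported if a set closed under outgoing arcs contains `w` and not `v`. -/
theorem insertArc_abort [Fintype V] {Δ : ℝ} {s : State V} {v w : V} {R : Set V}
    (hinn : ∀ x y, x ∈ s.inn y → y ∈ s.out x) (hR : ∀ x ∈ R, ∀ y ∈ s.out x, y ∈ R)
    (hw : w ∈ R) (hv : v ∉ R) (hpos : 0 < Δ)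
    (hΔ : Δ ≤ ((∑ z ∈ insert v (s.inn v), (s.inn z).card : ℕ) : ℝ))
    (hlev : s.level w ≤ s.level v) (hb : ¬s.Before v w) :
    (∃ r t, InsertArc Δ s v w r t) ∧ ∀ r t, InsertArc Δ s v w r t →
      ∃ s', r = some s' ∧ AfterRaise s v w s' t ∧ ∀ y ∉ R, s'.level y = s.level y := by
  have hback : ∀ r t, BackExec s.inn w Δ (.visit v) ⟨∅, [], 0⟩ r t → r = .abort := fun r t h =>
    h.eq_abort hw hv (fun y hy x hx hxR => hy (hR x hxR y (hinn x y hx))) hpos hΔ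
  have hstep : ∀ r t, BackStep Δ s v w r t →
      r = .forward (s.raise w (s.level v + 1)) [] := by
    intro r t h
    cases h with
    | cycle h => cases hback _ _ h
    | abort h => rfl
    | same h => cases hback _ _ h
    | differ h => cases hback _ _ h
  set s₀ := s.raise w (s.level v + 1) with hs₀
  have hne : ∀ r t, ForwardExec v w [] (.visit w) s₀ [] r t → r ≠ none := fun r t h =>
    h.ne_none hv hR (by rintro a b ⟨rfl, h⟩; exact hR _ hw _ h)
  constructor
  · obtain ⟨r, t, h⟩ := BackExec.exists_visit s.inn w Δ v ⟨∅, [], 0⟩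
    obtain rfl := hback _ _ h
    obtain ⟨r, t', h'⟩ := ForwardExec.exists_visit v w [] w s₀ []
    match r, h' with
    | none, h' => exact absurd rfl (hne _ _ h')
    | some (s', F'), h' => exact ⟨_, _, .forward hb (.abort h) h'⟩
  · intro r t h
    cases h with
    | ordered h => exact absurd h hb
    | back_cycle _ h => cases hstep _ _ h
    | skip _ h => cases hstep _ _ h
    | forward_cycle _ h hf =>
      cases hstep _ _ h
      exact absurd rfl (hne _ _ hf)
    | @forward s' s'' B F t t' _ h hf =>
      cases hstep _ _ h
      have I := hf.forwardDone _ _ rfl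
      have hKw : s₀.level w = s.level v + 1 := by simp [hs₀, State.raise]
      rw [hKw] at I
      set K := s.level v + 1 with hK
      have ho : s₀.out = s.out := rfl
      have hlz : ∀ z, z ≠ w → s₀.level z = s.level z := fun z hz => by
        simp [hs₀, State.raise, hz]
      have hvw : v ≠ w := by rintro rfl; exact hv hw
      have hRe := State.reindex_eq ([] ++ F) s''
      set s₂ := s''.reindex ([] ++ F) with hs₂
      have hw2 : s''.level w = K := by
        have := I.level_eq w
        omega
      have hv2 : s''.level v = s.level v := by
        rw [I.unchanged R hR (by rintro a b ⟨rfl, h⟩; exact hR _ hw _ h) v hv, hlz v hvw]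
      -- The level of `v` is unchanged because `v ∉ R`, and `w` is now one level higher, so the new
      -- arc enters no incoming set.
      have hin : (s₂.addArc v w).inn = s''.inn := by
        simp [State.addArc, hRe, hv2, hw2, hK]
      have hle : (s₂.addArc v w).level = s''.level := hRe.1
      have hou : ∀ x y, y ∈ (s₂.addArc v w).out x ↔ y ∈ s.out x ∨ (x, y) = (v, w) := by
        intro x y
        rw [State.mem_addArc_out, hRe.2.1, I.out_eq, ho]
      refine ⟨_, rfl, ⟨hou, by rw [hle, hw2], fun y hy => ?_, fun x z hx hz => ?_,
        fun x y hx => ?_, fun A hA hA' => ?_⟩, fun y hy => ?_⟩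
      · rw [hle, ← hlz y hy]
        exact I.level_eq y
      · rw [hle, hin]
        refine I.arc_spec x z ?_
        by_cases hxw : x = w
        · exact .inl ⟨hxw, by rw [← hxw]; exact hz⟩
        · rcases hx with h | h
          · exact absurd h hxw
          · refine .inr ⟨?_, hz⟩
            simp only [raisedTo, Finset.mem_filter, Finset.mem_univ, true_and, hlz x hxw]
            rwa [hle] at h
      · rw [hin] at hx
        refine (hou x y).2 (.inl ?_)
        rcases I.inn_sub x y hx with h | h | h
        · by_cases hyw : y = w
          · subst hyw
            simp [hs₀, State.raise] at h
          · refine hinn x y ?_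
            simpa [hs₀, State.raise, hyw] using h
        · exact h
        · obtain ⟨rfl, h⟩ := h
          exact h
      · have h1 := I.time_ge
        have h2 : A ⊆ raisedTo K s₀ s'' := by
          intro x hx
          have hxw : x ≠ w := by rintro rfl; exact hA hx
          simp only [raisedTo, Finset.mem_filter, Finset.mem_univ, true_and, hlz x hxw]
          have := hA' x hx
          rwa [hle] at this
        have h3 := Finset.sum_le_sum_of_subset (f := fun z => (s.out z).card) h2
        rw [ho] at h1
        omega
      · have hyw : y ≠ w := by rintro rfl; exact hy hw
        rw [hle, I.unchanged R hR (by rintro a b ⟨rfl, h⟩; exact hR _ hw _ h) y hy, hlz y hyw]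

end SparseCycle

namespace SparseCycle

variable {V : Type*}

/-! ### The hard instances -/

/-- The pairs of elements of `A` that `f` puts in increasing order. -/
def pairsLT {L : Type*} [LinearOrder L] (f : V → L) (A : Finset V) : Finset (V × V) :=
  (A ×ˢ A).filter fun p => f p.1 < f p.2

theorem mem_pairsLT {L : Type*} [LinearOrder L] {f : V → L} {A : Finset V} {x y : V} :
    (x, y) ∈ pairsLT f A ↔ x ∈ A ∧ y ∈ A ∧ f x < f y := by
  simp [pairsLT, and_assoc]

theorem card_pairsLT [DecidableEq V] {L : Type*} [LinearOrder L] {f : V → L} (hf : Function.Injective f)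
    (A : Finset V) : (pairsLT f A).card = A.card * (A.card - 1) / 2 := by
  have h1 : (pairsLT f A).card = ((pairsLT f A).image Prod.swap).card :=
    (Finset.card_image_of_injective _ Prod.swap_injective).symm
  have h2 : pairsLT f A ∪ (pairsLT f A).image Prod.swap = A.offDiag := by
    ext ⟨x, y⟩
    have : x ≠ y ↔ f x < f y ∨ f y < f x := by
      rw [← hf.ne_iff]; exact ne_iff_lt_or_gt
    simp only [Finset.mem_union, Finset.mem_image, Prod.exists, mem_pairsLT, Prod.swap_prod_mk,
      Prod.mk.injEq, Finset.mem_offDiag, this]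
    constructor
    · rintro (h | ⟨a, b, h, rfl, rfl⟩) <;> tauto
    · rintro ⟨hx, hy, h | h⟩
      · exact .inl ⟨hx, hy, h⟩
      · exact .inr ⟨y, x, ⟨hy, hx, h⟩, rfl, rfl⟩
  have h3 : Disjoint (pairsLT f A) ((pairsLT f A).image Prod.swap) := by
    rw [Finset.disjoint_left]
    rintro ⟨x, y⟩ h h'
    simp only [Finset.mem_image, Prod.exists, mem_pairsLT, Prod.swap_prod_mk,
      Prod.mk.injEq] at h h'
    obtain ⟨a, b, h', rfl, rfl⟩ := h'
    exact lt_asymm h.2.2 h'.2.2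
  have h4 := Finset.card_union_of_disjoint h3
  rw [h2, Finset.offDiag_card, ← h1] at h4
  rw [Nat.mul_sub_one]
  omega

/-- Used twice: with outgoing arcs for the cost of the hub, and with incoming arcs and the negated
index for the arcs of a block. -/
theorem sum_card_ge_card_pairsLT {L : Type*} [LinearOrder L] {f : V → L} {A : Finset V}
    {S : V → Finset V} (h : ∀ x ∈ A, ∀ y ∈ A, f x < f y → y ∈ S x) :
    (pairsLT f A).card ≤ ∑ x ∈ A, (S x).card := by
  rw [← Finset.card_sigma]
  refine Finset.card_le_card_of_injOn (fun p => ⟨p.1, p.2⟩) ?_ ?_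
  · rintro ⟨x, y⟩ hp
    have hp := mem_pairsLT.1 (Finset.mem_coe.1 hp)
    simpa using ⟨hp.1, h x hp.1 y hp.2.1 hp.2.2⟩
  · rintro ⟨x, y⟩ _ ⟨x', y'⟩ _ h
    simpa using h

/-- A partition of the vertices into blocks `1, …, k` of `s` vertices, whose initial indices
increase from block to block, and a block `0` of vertices with larger indices, some of which form
the hub. -/
structure Layout [Fintype V] (i₀ : V → ℤ) (k s : ℕ) where
  block : V → ℕ
  first : ℕ → V
  last : ℕ → V
  hub : Finset V
  idx_injective : Function.Injective i₀
  block_le : ∀ x, block x ≤ k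
  idx_lt_of_block_eq_zero : ∀ x y, block x ≠ 0 → block y = 0 → i₀ x < i₀ y
  idx_lt_of_block_lt : ∀ x y, 0 < block y → block y < block x → i₀ y < i₀ x
  card_block : ∀ b, 1 ≤ b → b ≤ k → (Finset.univ.filter fun x => block x = b).card = s
  block_first : ∀ b, 1 ≤ b → b ≤ k → block (first b) = b
  first_le : ∀ x, block x ≠ 0 → i₀ (first (block x)) ≤ i₀ x
  block_last : ∀ b, 1 ≤ b → b ≤ k → block (last b) = b
  le_last : ∀ x, block x ≠ 0 → i₀ x ≤ i₀ (last (block x))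
  block_hub : ∀ x ∈ hub, block x = 0

namespace Layout

variable [Fintype V] {i₀ : V → ℤ} {k s : ℕ} (L : Layout i₀ k s)

/-- The final topological order. -/
def key (x : V) : ℕᵒᵈ ×ₗ ℤ := toLex (OrderDual.toDual (L.block x), i₀ x)

theorem key_lt {x y : V} :
    L.key x < L.key y ↔ L.block y < L.block x ∨ L.block x = L.block y ∧ i₀ x < i₀ y := by
  simp [key, Prod.Lex.toLex_lt_toLex]

theorem key_injective : Function.Injective L.key := by
  intro x y h
  simp only [key, EmbeddingLike.apply_eq_iff_eq, Prod.mk.injEq] at h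
  exact L.idx_injective h.2

/-- The arcs from the last vertex of a block to the first vertex of the previous block, starting
from the block `j`. -/
def chain : ℕ → List (V × V)
  | 0 => []
  | 1 => []
  | j + 2 => (L.last (j + 2), L.first (j + 1)) :: chain (j + 1)

theorem mem_chain {j : ℕ} {a : V × V} (h : a ∈ L.chain j) :
    ∃ b, 1 ≤ b ∧ b + 1 ≤ j ∧ a = (L.last (b + 1), L.first b) := by
  induction j with
  | zero => simp [chain] at h
  | succ j ih =>
    cases j with
    | zero => simp [chain] at h
    | succ j =>
      rcases List.mem_cons.1 h with h | h
      · exact ⟨j + 1, by omega, by omega, h⟩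
      · obtain ⟨b, h1, h2, h3⟩ := ih h
        exact ⟨b, h1, by omega, h3⟩

theorem length_chain (j : ℕ) : (L.chain j).length = j - 1 := by
  induction j with
  | zero => rfl
  | succ j ih =>
    cases j with
    | zero => rfl
    | succ j => simp only [chain, List.length_cons, ih]; omega

theorem nodup_chain {j : ℕ} (hj : j ≤ k) : (L.chain j).Nodup := by
  induction j with
  | zero => simp [chain]
  | succ j ih =>
    cases j with
    | zero => simp [chain]
    | succ j =>
      refine List.nodup_cons.2 ⟨fun h => ?_, ih (by omega)⟩
      obtain ⟨b, h1, h2, h3⟩ := L.mem_chain h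
      have h4 := congrArg L.block (Prod.mk.inj h3).2
      rw [L.block_first _ (by omega) (by omega), L.block_first _ h1 (by omega)] at h4
      omega

variable [DecidableEq V]

/-! ### Core arcs -/

/-- The arcs within a block, within the hub, and from the first vertices of the blocks to the
hub. -/
def core : Finset (V × V) :=
  ((Finset.Icc 1 k).biUnion fun b => pairsLT i₀ (Finset.univ.filter fun x => L.block x = b)) ∪
    pairsLT i₀ L.hub ∪ (Finset.Icc 1 k).biUnion fun b => L.hub.image fun y => (L.first b, y)

theorem mem_core_of_block {x y : V} (h0 : L.block x ≠ 0) (h : L.block x = L.block y)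
    (hi : i₀ x < i₀ y) : (x, y) ∈ L.core := by
  have := L.block_le x
  refine Finset.mem_union_left _ (Finset.mem_union_left _ (Finset.mem_biUnion.2
    ⟨L.block x, Finset.mem_Icc.2 ⟨by omega, this⟩, mem_pairsLT.2 ⟨by simp, by simp [h], hi⟩⟩))

theorem mem_core_of_hub {x y : V} (hx : x ∈ L.hub) (hy : y ∈ L.hub) (hi : i₀ x < i₀ y) :
    (x, y) ∈ L.core :=
  Finset.mem_union_left _ (Finset.mem_union_right _ (mem_pairsLT.2 ⟨hx, hy, hi⟩))

theorem first_mem_core {b : ℕ} (h1 : 1 ≤ b) (h2 : b ≤ k) {y : V} (hy : y ∈ L.hub) :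
    (L.first b, y) ∈ L.core :=
  Finset.mem_union_right _ (Finset.mem_biUnion.2
    ⟨b, Finset.mem_Icc.2 ⟨h1, h2⟩, Finset.mem_image_of_mem _ hy⟩)

/-- The second part is the condition that places an arc in the batch inserted before the chain. -/
theorem of_mem_core {x y : V} (h : (x, y) ∈ L.core) :
    L.key x < L.key y ∧ (L.block y = 0 ∨ L.block x = L.block y) := by
  rw [L.key_lt]
  simp only [core, Finset.mem_union, Finset.mem_biUnion, mem_pairsLT, Finset.mem_filter,
    Finset.mem_univ, true_and, Finset.mem_image, Finset.mem_Icc, Prod.mk.injEq] at h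
  rcases h with (⟨b, hb, hx, hy, h⟩ | ⟨hx, hy, h⟩) | ⟨b, hb, z, hz, rfl, rfl⟩
  · exact ⟨.inr ⟨hx.trans hy.symm, h⟩, .inr (hx.trans hy.symm)⟩
  · have h1 := L.block_hub x hx
    have h2 := L.block_hub y hy
    exact ⟨.inr ⟨h1.trans h2.symm, h⟩, .inl h2⟩
  · have h1 := L.block_hub z hz
    have h2 := L.block_first b hb.1 hb.2
    exact ⟨.inl (by omega), .inl h1⟩

theorem card_core_le : L.core.card ≤ k * (s * (s - 1) / 2) +
    L.hub.card * (L.hub.card - 1) / 2 + k * L.hub.card := by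
  refine (Finset.card_union_le _ _).trans (add_le_add ((Finset.card_union_le _ _).trans
    (add_le_add ?_ ?_)) ?_)
  · refine (Finset.card_biUnion_le_card_mul _ _ (s * (s - 1) / 2) fun b hb => ?_).trans
      (by simp)
    have hb := Finset.mem_Icc.1 hb
    rw [card_pairsLT L.idx_injective, L.card_block b hb.1 hb.2]
  · rw [card_pairsLT L.idx_injective]
  · refine (Finset.card_biUnion_le_card_mul _ _ L.hub.card fun b hb => ?_).trans (by simp)
    exact Finset.card_image_le

/-! ### Processing the chain -/

/-- The state of the algorithm when the blocks from `j` on have got their final levels. -/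
structure Stage (j : ℕ) (σ : State V) : Prop where
  block_of_mem_out : ∀ x y, y ∈ σ.out x →
    L.block y = 0 ∨ L.block x = L.block y ∨ j < L.block x
  core_sub : ∀ x y, (x, y) ∈ L.core → y ∈ σ.out x
  level_of_le : ∀ x, j ≤ L.block x → σ.level x = k + 1 - L.block x
  level_of_lt : ∀ x, L.block x ≠ 0 → L.block x < j → σ.level x = 1
  level_zero : ∀ x, L.block x = 0 → σ.level x ≤ k + 1 - j
  mem_inn : ∀ x y, L.block x = j → L.block y = j → i₀ x < i₀ y → x ∈ σ.inn y
  mem_out_of_mem_inn : ∀ x y, x ∈ σ.inn y → y ∈ σ.out x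
  not_before : ∀ x y, L.block x = j → L.block y ≠ 0 → L.block y < j → ¬σ.Before x y

variable {L}

/-- No arc leaves the union of block `j` and block `0` yet, so this union serves as the closed set
that contains `w` and not `v`. Everything in it lies below the new level, hence block `j` and the
hub, all reached directly from `w`, are raised. -/
theorem Stage.step {Δ : ℝ} {j : ℕ} {σ : State V} (h : L.Stage (j + 1) σ) (hj : 1 ≤ j)
    (hjk : j + 1 ≤ k) (hpos : 0 < Δ) (hΔ : Δ ≤ ((s * (s - 1) / 2 : ℕ) : ℝ)) :
    (∃ r t, InsertArc Δ σ (L.last (j + 1)) (L.first j) r t) ∧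
    ∀ r t, InsertArc Δ σ (L.last (j + 1)) (L.first j) r t → ∃ σ', r = some σ' ∧
      1 + L.hub.card * (L.hub.card - 1) / 2 ≤ t ∧ L.Stage j σ' := by
  set v := L.last (j + 1) with hv
  set w := L.first j with hw
  have hbv : L.block v = j + 1 := L.block_last _ (by omega) hjk
  have hbw : L.block w = j := L.block_first _ hj (by omega)
  have hlv : σ.level v = k - j := by rw [h.level_of_le v hbv.ge, hbv]; omega
  have hlw : σ.level w = 1 := h.level_of_lt w (by omega) (by omega)
  set A := Finset.univ.filter fun x => L.block x = j + 1 with hA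
  have hsum : s * (s - 1) / 2 ≤ ∑ z ∈ insert v (σ.inn v), (σ.inn z).card := by
    -- As `v` is the last vertex of a complete acyclic block, `v` and its direct predecessors
    -- already include the whole block.
    have h1 : A ⊆ insert v (σ.inn v) := by
      intro x hx
      have hx : L.block x = j + 1 := by simpa [hA] using hx
      by_cases hxv : x = v
      · simp [hxv]
      · refine Finset.mem_insert_of_mem (h.mem_inn x v hx hbv (lt_of_le_of_ne ?_ fun h => ?_))
        · have := L.le_last x (by omega)
          rwa [hx] at this
        · exact hxv (L.idx_injective h)
    have h2 := Finset.sum_le_sum_of_subset (f := fun z => (σ.inn z).card) h1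
    have h3 : (pairsLT (fun x => -i₀ x) A).card ≤ ∑ x ∈ A, (σ.inn x).card := by
      refine sum_card_ge_card_pairsLT fun x hx y hy hxy => ?_
      exact h.mem_inn y x (by simpa [hA] using hy) (by simpa [hA] using hx) (by omega)
    rw [card_pairsLT (fun x y hxy => L.idx_injective (neg_inj.1 hxy)), hA,
      L.card_block _ (by omega) hjk] at h3
    exact h3.trans h2
  obtain ⟨hex, hall⟩ := insertArc_abort (Δ := Δ) (s := σ) (v := v) (w := w)
    (R := {x | L.block x = j ∨ L.block x = 0}) h.mem_out_of_mem_inn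
    (by
      intro x hx y hy
      have := h.block_of_mem_out x y hy
      simp only [Set.mem_ofPred_eq] at hx ⊢
      omega)
    (.inl hbw) (by simp only [Set.mem_ofPred_eq]; omega) hpos
    (hΔ.trans (by exact_mod_cast hsum)) (by omega)
    (h.not_before v w hbv (by omega) (by omega))
  refine ⟨hex, fun r t hr => ?_⟩
  obtain ⟨σ', rfl, I, hun⟩ := hall r t hr
  have hK : σ.level v + 1 = k + 1 - j := by omega
  have hlow : ∀ x, L.block x = j ∨ L.block x = 0 → σ.level x < σ.level v + 1 := by
    intro x hx
    rcases hx with hx | hx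
    · have := h.level_of_lt x (by omega) (by omega)
      omega
    · have := h.level_zero x hx
      omega
  -- The head of an arc leaving a visited vertex ends at least on the new level. A head in block `j`
  -- or `0` started below it and cannot exceed it.
  have hup : ∀ x z, x = w ∨ σ.level x < σ.level v + 1 ∧ σ'.level x = σ.level v + 1 →
      z ∈ σ.out x → L.block z = j ∨ L.block z = 0 →
      σ'.level z = σ.level v + 1 ∧ x ∈ σ'.inn z := by
    intro x z hx hz hb
    have h1 := I.le_level x z hx hz
    have h2 := hlow z hb
    have h3 : σ'.level z = σ.level v + 1 := by
      by_cases hzw : z = w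
      · rw [hzw]; exact I.level_head
      · have := I.level_eq z hzw
        omega
    exact ⟨h3, h1.2 h3⟩
  have hblock : ∀ x, L.block x = j → σ'.level x = σ.level v + 1 := by
    intro x hx
    by_cases hxw : x = w
    · rw [hxw]; exact I.level_head
    · refine (hup w x (.inl rfl) (h.core_sub _ _ (L.mem_core_of_block (by omega)
        (hbw.trans hx.symm) (lt_of_le_of_ne ?_ fun h => ?_))) (.inl hx)).1
      · have := L.first_le x (by omega)
        rwa [hx] at this
      · exact hxw (L.idx_injective h).symm
  have hhub : ∀ x ∈ L.hub, σ'.level x = σ.level v + 1 := fun x hx =>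
    (hup w x (.inl rfl) (h.core_sub _ _ (L.first_mem_core hj (by omega) hx))
      (.inr (L.block_hub x hx))).1
  have hlevel : ∀ x, L.block x ≠ j → L.block x ≠ 0 → σ'.level x = σ.level x := fun x h1 h2 =>
    hun x (by simp only [Set.mem_ofPred_eq]; omega)
  have hlo : ∀ x, L.block x ≠ 0 → L.block x < j → σ'.level x = 1 := fun x h0 hx => by
    rw [hlevel x (by omega) h0]
    exact h.level_of_lt x h0 (by omega)
  refine ⟨σ', rfl, ?_, ⟨fun x y hy => ?_, fun x y hxy => ?_, fun x hx => ?_, hlo,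
    fun x hx => ?_, fun x y hx hy hxy => ?_, I.mem_out_of_mem_inn, fun x y hx hy0 hy hB => ?_⟩⟩
  · have h1 := I.time_ge L.hub (fun hwh => by have := L.block_hub w hwh; omega)
      fun x hx => ⟨hlow x (.inr (L.block_hub x hx)), hhub x hx⟩
    have h2 : (pairsLT i₀ L.hub).card ≤ ∑ x ∈ L.hub, (σ.out x).card :=
      sum_card_ge_card_pairsLT fun x hx y hy hxy => h.core_sub _ _ (L.mem_core_of_hub hx hy hxy)
    rw [card_pairsLT L.idx_injective] at h2
    omega
  · rcases (I.mem_out x y).1 hy with hy | hy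
    · have := h.block_of_mem_out x y hy
      omega
    · obtain ⟨rfl, rfl⟩ := Prod.mk.inj hy
      omega
  · exact (I.mem_out x y).2 (.inl (h.core_sub x y hxy))
  · by_cases hxj : L.block x = j
    · rw [hblock x hxj, hxj, hK]
    · rw [hlevel x hxj (by omega)]
      exact h.level_of_le x (by omega)
  · have hxw : x ≠ w := by rintro rfl; omega
    have h1 := I.level_eq x hxw
    have h2 := h.level_zero x hx
    omega
  · refine (hup x y ?_ (h.core_sub _ _ (L.mem_core_of_block (by omega)
      (hx.trans hy.symm) hxy)) (.inl hy)).2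
    exact .inr ⟨hlow x (.inl hx), hblock x hx⟩
  -- The levels alone decide: block `j` is now above level one, while lower nonzero blocks are still
  -- on it.
  · have h1 := hblock x hx
    have h2 := hlo y hy0 hy
    rcases hB with hB | hB <;> omega

/-- The list `l` holds the arcs inserted after the chain; their analysis needs only the final levels
of the blocks. -/
theorem Stage.runsAtLeast {Δ : ℝ} {T : ℕ} {l : List (V × V)} (hpos : 0 < Δ)
    (hΔ : Δ ≤ ((s * (s - 1) / 2 : ℕ) : ℝ))
    (hl : ∀ σ : State V, (∀ x, L.block x ≠ 0 → σ.level x = k + 1 - L.block x) →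
      RunsAtLeast Δ σ l T) {j : ℕ} (hj : j + 1 ≤ k) (σ : State V) (h : L.Stage (j + 1) σ) :
    RunsAtLeast Δ σ (L.chain (j + 1) ++ l)
      (j * (1 + L.hub.card * (L.hub.card - 1) / 2) + T) := by
  induction j generalizing σ with
  | zero => simpa [chain] using hl σ fun x hx => h.level_of_le x (by omega)
  | succ j ih =>
    obtain ⟨hex, hall⟩ := h.step (by omega) hj hpos hΔ
    refine (RunsAtLeast.cons hex fun r t hr => ?_).mono (T := (1 + L.hub.card *
      (L.hub.card - 1) / 2) + (j * (1 + L.hub.card * (L.hub.card - 1) / 2) + T)) ?_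
    · obtain ⟨σ', h1, h2, h3⟩ := hall r t hr
      exact ⟨σ', h1, h2, ih (by omega) σ' h3⟩
    · rw [Nat.succ_mul]; omega

variable (L)

/-- Three batches suffice. Arcs within a block or into block `0` go first and agree with the initial
indices; then comes the chain; the other arcs go from a higher to a lower nonzero block and, once
the chain is done, agree with the levels. -/
theorem exists_runsAtLeast {Δ : ℝ} (hpos : 0 < Δ) (hΔ : Δ ≤ ((s * (s - 1) / 2 : ℕ) : ℝ))
    {T : Finset (V × V)} (hcore : L.core ⊆ T) (hchain : ∀ a ∈ L.chain k, a ∈ T)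
    (hkey : T ⊆ pairsLT L.key Finset.univ) {σ : State V} (hlev : ∀ x, σ.level x = 1)
    (hidx : σ.idx = i₀) (hout : ∀ x, σ.out x = ∅) (hinn : ∀ x, σ.inn x = ∅) :
    ∃ l : List (V × V), l.Nodup ∧ l.toFinset = T ∧
      RunsAtLeast Δ σ l (T.card + (k - 1) * (L.hub.card * (L.hub.card - 1) / 2)) := by
  have hT : ∀ x y, (x, y) ∈ T →
      L.block y < L.block x ∨ L.block x = L.block y ∧ i₀ x < i₀ y := fun x y h =>
    L.key_lt.1 (mem_pairsLT.1 (hkey h)).2.2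
  set S := T.filter fun a => L.block a.2 = 0 ∨ L.block a.1 = L.block a.2 with hS
  set U := (T \ S) \ (L.chain k).toFinset with hU
  have hcS : ∀ a ∈ L.chain k, a ∉ S := by
    intro a ha
    obtain ⟨b, h1, h2, rfl⟩ := L.mem_chain ha
    have h3 := L.block_first b h1 (by omega)
    have h4 := L.block_last (b + 1) (by omega) h2
    simp only [hS, Finset.mem_filter, not_and]
    intro
    omega
  have hnodup : (S.toList ++ (L.chain k ++ U.toList)).Nodup := by
    refine (Finset.nodup_toList _).append ((L.nodup_chain le_rfl).append
      (Finset.nodup_toList _) ?_) ?_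
    · intro a h1 h2
      simp [hU, h1] at h2
    · intro a h1 h2
      rw [Finset.mem_toList] at h1
      rcases List.mem_append.1 h2 with h2 | h2
      · exact hcS a h2 h1
      · simp [hU, h1] at h2
  have hset : (S.toList ++ (L.chain k ++ U.toList)).toFinset = T := by
    ext a
    simp only [List.mem_toFinset, List.mem_append, Finset.mem_toList]
    constructor
    · rintro (h | h | h)
      · exact (Finset.mem_filter.1 h).1
      · exact hchain a h
      · simp only [hU, Finset.mem_sdiff] at h
        exact h.1.1
    · intro h
      by_cases h1 : a ∈ S
      · exact .inl h1
      by_cases h2 : a ∈ L.chain k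
      · exact .inr (.inl h2)
      · simp [hU, h, h1, h2]
  have hcard : S.card + ((L.chain k).length + U.card) = T.card := by
    rw [← hset, List.toFinset_card_of_nodup hnodup]
    simp
  refine ⟨_, hnodup, hset, ?_⟩
  have hU' : ∀ σ : State V, (∀ x, L.block x ≠ 0 → σ.level x = k + 1 - L.block x) →
      RunsAtLeast Δ σ U.toList U.card := by
    intro τ hτ
    have := RunsAtLeast.append_ordered (Δ := Δ) U.toList τ ?_ (RunsAtLeast.nil Δ _)
    · simpa using this
    rintro ⟨x, y⟩ ha
    simp only [Finset.mem_toList, hU, Finset.mem_sdiff] at ha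
    have h1 := hT x y ha.1.1
    have h2 := ha.1.2
    simp only [hS, Finset.mem_filter, not_and, not_or] at h2
    have h2 := h2 ha.1.1
    have h3 := L.block_le x
    left
    simp only
    rw [hτ x (by omega), hτ y h2.1]
    omega
  have hSb : ∀ x y, (x, y) ∈ S → i₀ x < i₀ y := by
    intro x y h
    have h := Finset.mem_filter.1 h
    have h1 := hT x y h.1
    have h2 := h.2
    simp only at h2
    rcases h1 with h1 | h1
    · exact L.idx_lt_of_block_eq_zero x y (by omega) (by omega)
    · exact h1.2
  have hmain : RunsAtLeast Δ (σ.addArcs S.toList) (L.chain k ++ U.toList)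
      ((k - 1) * (1 + L.hub.card * (L.hub.card - 1) / 2) + U.card) := by
    -- For `k = 0` there is no chain and no stage to start from; otherwise the first batch leads to
    -- stage `k`, with all levels still equal to one.
    rcases Nat.eq_zero_or_pos k with hk | hk
    · have h1 : L.chain k = [] := List.length_eq_zero_iff.1 (by rw [L.length_chain]; omega)
      rw [h1]
      refine (hU' _ fun x hx => ?_).mono (by simp [hk])
      have := L.block_le x
      omega
    obtain ⟨j, rfl⟩ : ∃ j, k = j + 1 := ⟨k - 1, by omega⟩
    refine Stage.runsAtLeast hpos hΔ hU' le_rfl _ ?_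
    have hl : ∀ x, (σ.addArcs S.toList).level x = 1 := by rw [State.addArcs_level]; exact hlev
    have ho : ∀ x y, y ∈ (σ.addArcs S.toList).out x ↔ (x, y) ∈ S := by
      intro x y
      rw [State.mem_addArcs_out, hout]
      simp
    have hi : ∀ x y, x ∈ (σ.addArcs S.toList).inn y ↔ (x, y) ∈ S := by
      intro x y
      rw [State.mem_addArcs_inn, hinn, hlev, hlev]
      simp
    have hcoreS : ∀ x y, (x, y) ∈ L.core → (x, y) ∈ S := fun x y h =>
      Finset.mem_filter.2 ⟨hcore h, (L.of_mem_core h).2⟩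
    refine ⟨fun x y h => ?_, fun x y h => (ho x y).2 (hcoreS x y h), fun x hx => ?_,
      fun x _ _ => hl x, fun x _ => by rw [hl]; omega, fun x y hx hy hxy => ?_,
      fun x y h => (ho x y).2 ((hi x y).1 h), fun x y hx hy0 hy hB => ?_⟩
    · have := (Finset.mem_filter.1 ((ho x y).1 h)).2
      simp only at this
      omega
    · have := L.block_le x
      rw [hl]
      omega
    · exact (hi x y).2 (hcoreS x y (L.mem_core_of_block (by omega) (hx.trans hy.symm) hxy))
    · have h1 := L.idx_lt_of_block_lt x y (by omega) (by omega)
      rcases hB with hB | ⟨_, hB⟩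
      · rw [hl, hl] at hB
        omega
      · rw [State.addArcs_idx, hidx] at hB
        omega
  have := RunsAtLeast.append_ordered S.toList σ ?_ hmain
  · refine this.mono ?_
    have h1 := L.length_chain k
    rw [mul_add, mul_one, Finset.length_toList]
    omega
  rintro ⟨x, y⟩ ha
  right
  rw [hlev, hlev, hidx]
  exact ⟨rfl, hSb x y (by simpa using ha)⟩

end Layout
end SparseCycle

/-! ### Existence of layouts and choice of the sizes -/

namespace SparseCycle

/-- The `n` distinct indices fill the range from `-n` to `-1`, so `i₀ x + n` is a rank. Blocks and
hub are intervals of ranks. -/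
theorem exists_layout {n : ℕ} {i₀ : Fin n → ℤ} (h : IsInitialIndexing i₀) (hn : 0 < n)
    {k s q : ℕ} (hs : 0 < s) (hq : k * s + q ≤ n) : ∃ L : Layout i₀ k s, L.hub.card = q := by
  obtain ⟨hinj, hrange⟩ := h
  obtain ⟨f, hf⟩ : ∃ f : Fin n → Fin n, ∀ x, ((f x : ℕ) : ℤ) = i₀ x + n := by
    refine ⟨fun x => ⟨(i₀ x + n).toNat, ?_⟩, fun x => ?_⟩
    · have := hrange x
      omega
    · have := hrange x
      simp only
      omega
  have hfb : Function.Bijective f := by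
    refine Function.Injective.bijective_of_finite fun x y hxy => hinj ?_
    have h1 := hf x
    have h2 := hf y
    rw [hxy] at h1
    omega
  have hcount : ∀ a c, a + c ≤ n →
      (Finset.univ.filter fun x => a ≤ (f x : ℕ) ∧ (f x : ℕ) < a + c).card = c := by
    intro a c hac
    have h1 : (Finset.univ.filter fun x => a ≤ (f x : ℕ) ∧ (f x : ℕ) < a + c).image
        (fun x => (f x : ℕ)) = Finset.Ico a (a + c) := by
      ext z
      simp only [Finset.mem_image, Finset.mem_filter, Finset.mem_univ, true_and, Finset.mem_Ico]
      constructor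
      · rintro ⟨x, hx, rfl⟩
        exact hx
      · intro hz
        obtain ⟨x, hx⟩ := hfb.surjective ⟨z, by omega⟩
        exact ⟨x, by simpa [hx] using hz, by simp [hx]⟩
    rw [← Finset.card_image_of_injective _ (Fin.val_injective.comp hfb.injective)]
    simpa [Function.comp_def] using congrArg Finset.card h1
  set block : Fin n → ℕ := fun x => if (f x : ℕ) < k * s then f x / s + 1 else 0 with hblock
  have hle : ∀ x, block x ≤ k := by
    intro x
    simp only [hblock]
    split
    · rename_i hx
      exact (Nat.div_lt_iff_lt_mul hs).2 hx
    · exact Nat.zero_le _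
  have hzero : ∀ x, block x = 0 ↔ k * s ≤ (f x : ℕ) := by
    intro x
    simp only [hblock]
    split <;> simp_all
  have hcard : ∀ b, 1 ≤ b → b ≤ k → (Finset.univ.filter fun x => block x = b).card = s := by
    intro b h1 h2
    obtain ⟨c, rfl⟩ : ∃ c, b = c + 1 := ⟨b - 1, by omega⟩
    have h3 : (c + 1) * s ≤ k * s := Nat.mul_le_mul_right s h2
    rw [Nat.succ_mul] at h3
    rw [← hcount (c * s) s (by omega)]
    congr 1
    ext x
    simp only [Finset.mem_filter, Finset.mem_univ, true_and, hblock]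
    have h4 : (f x : ℕ) / s = c ↔ c * s ≤ (f x : ℕ) ∧ (f x : ℕ) < c * s + s := by
      rw [Nat.div_eq_iff hs]
      omega
    split
    · rw [← h4]; omega
    · constructor
      · rintro ⟨⟩
      · omega
  have hlt : ∀ x y, (f x : ℕ) < f y ↔ i₀ x < i₀ y := by
    intro x y
    have h1 := hf x
    have h2 := hf y
    omega
  have hne : ∀ b, 1 ≤ b → b ≤ k → (Finset.univ.filter fun x => block x = b).Nonempty :=
    fun b h1 h2 => Finset.card_pos.1 (by rw [hcard b h1 h2]; exact hs)
  have hfirst : ∀ b, ∃ x, 1 ≤ b → b ≤ k → block x = b ∧ ∀ y, block y = b → i₀ x ≤ i₀ y := by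
    intro b
    by_cases hb : 1 ≤ b ∧ b ≤ k
    · obtain ⟨x, hx, hmin⟩ := Finset.exists_min_image _ i₀ (hne b hb.1 hb.2)
      exact ⟨x, fun _ _ => ⟨by simpa using hx, fun y hy => hmin y (by simpa using hy)⟩⟩
    · exact ⟨⟨0, hn⟩, fun h1 h2 => absurd ⟨h1, h2⟩ hb⟩
  have hlast : ∀ b, ∃ x, 1 ≤ b → b ≤ k → block x = b ∧ ∀ y, block y = b → i₀ y ≤ i₀ x := by
    intro b
    by_cases hb : 1 ≤ b ∧ b ≤ k
    · obtain ⟨x, hx, hmax⟩ := Finset.exists_max_image _ i₀ (hne b hb.1 hb.2)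
      exact ⟨x, fun _ _ => ⟨by simpa using hx, fun y hy => hmax y (by simpa using hy)⟩⟩
    · exact ⟨⟨0, hn⟩, fun h1 h2 => absurd ⟨h1, h2⟩ hb⟩
  choose first hfirst using hfirst
  choose last hlast using hlast
  refine ⟨{ block := block, first := first, last := last,
            hub := Finset.univ.filter fun x => k * s ≤ (f x : ℕ) ∧ (f x : ℕ) < k * s + q,
            idx_injective := hinj, block_le := hle,
            idx_lt_of_block_eq_zero := fun x y hx hy => ?_,
            idx_lt_of_block_lt := fun x y hy hxy => ?_,
            card_block := hcard,
            block_first := fun b h1 h2 => (hfirst b h1 h2).1,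
            first_le := fun x hx => (hfirst _ (by omega) (hle x)).2 x rfl,
            block_last := fun b h1 h2 => (hlast b h1 h2).1,
            le_last := fun x hx => (hlast _ (by omega) (hle x)).2 x rfl,
            block_hub := fun x hx => ?_ }, hcount _ _ hq⟩
  · rw [← hlt]
    have h1 := hzero x
    have h2 := hzero y
    omega
  · rw [← hlt]
    by_contra hle
    refine absurd hxy (not_lt.2 ?_)
    have h1 : (f x : ℕ) ≤ f y := by omega
    have h2 := Nat.div_le_div_right (c := s) h1
    have h3 := hzero y
    simp only [hblock]
    split_ifs <;> omega
  · exact (hzero x).2 (Finset.mem_filter.1 hx).2.1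

theorem searchBound_nonneg (n m : ℕ) : 0 ≤ searchBound n m := by
  unfold searchBound; positivity

theorem searchBound_sq_le (n m : ℕ) : searchBound n m ^ 2 ≤ m := by
  calc searchBound n m ^ 2 ≤ ((m : ℝ) ^ (1 / 2 : ℝ)) ^ 2 :=
        pow_le_pow_left₀ (searchBound_nonneg n m) (min_le_left _ _) 2
    _ = m := by rw [← Real.rpow_natCast, ← Real.rpow_mul (by positivity)]; norm_num

theorem searchBound_cube_le (n m : ℕ) : searchBound n m ^ 3 ≤ (n : ℝ) ^ 2 := by
  calc searchBound n m ^ 3 ≤ ((n : ℝ) ^ (2 / 3 : ℝ)) ^ 3 :=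
        pow_le_pow_left₀ (searchBound_nonneg n m) (min_le_right _ _) 3
    _ = (n : ℝ) ^ 2 := by
        rw [← Real.rpow_natCast, ← Real.rpow_mul (by positivity), ← Real.rpow_natCast]; norm_num

/-- The numbers and sizes of the blocks and of the hub in a hard instance. -/
theorem exists_parameters {n m : ℕ} (hmn : m ≤ n * (n - 1) / 2) :
    ∃ k s q : ℕ, 0 < s ∧ k * s + q ≤ n ∧ searchBound n m ≤ ((s * (s - 1) / 2 : ℕ) : ℝ) ∧
      k * (s * (s - 1) / 2) + q * (q - 1) / 2 + k * q + (k - 1) ≤ m ∧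
      1 / 16384 * (searchBound n m * m) ≤ ((m + (k - 1) * (q * (q - 1) / 2) : ℕ) : ℝ) := by
  have hD0 := searchBound_nonneg n m
  have hD2 := searchBound_sq_le n m
  have hD3 := searchBound_cube_le n m
  set D := searchBound n m
  set d := ⌊D⌋₊
  have hd : (d : ℝ) ≤ D := Nat.floor_le hD0
  have hd' : D < d + 1 := Nat.lt_floor_add_one D
  have hd2 : d ^ 2 ≤ m := by
    have : (d : ℝ) ^ 2 ≤ m := (pow_le_pow_left₀ (by positivity) hd 2).trans hD2
    exact_mod_cast this
  have hd3 : d ^ 3 ≤ n ^ 2 := by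
    have : (d : ℝ) ^ 3 ≤ (n : ℝ) ^ 2 := (pow_le_pow_left₀ (by positivity) hd 3).trans hD3
    exact_mod_cast this
  set r := Nat.sqrt d
  have hr : r * r ≤ d := Nat.sqrt_le d
  have hr' : d < (r + 1) * (r + 1) := Nat.lt_succ_sqrt d
  have hs : 2 * (r + 1) * (2 * (r + 1) - 1) / 2 = (r + 1) * (2 * r + 1) := by
    rw [mul_assoc, Nat.mul_div_cancel_left _ two_pos]
    congr 1
  have hsD : D ≤ ((2 * (r + 1) * (2 * (r + 1) - 1) / 2 : ℕ) : ℝ) := by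
    rw [hs]
    have : d + 1 ≤ (r + 1) * (2 * r + 1) := by nlinarith
    have : ((d + 1 : ℕ) : ℝ) ≤ ((r + 1) * (2 * r + 1) : ℕ) := by exact_mod_cast this
    push_cast at this ⊢
    linarith
  -- For bounded `Δ` one unit of time per arc is enough, so no blocks and no hub are needed.
  rcases lt_or_ge d 128 with hsmall | hlarge
  · refine ⟨0, 2 * (r + 1), 0, by omega, by omega, hsD, by simp, ?_⟩
    have h1 : (d : ℝ) ≤ 128 := by exact_mod_cast hsmall.le
    have h2 : (0 : ℝ) ≤ m := by positivity
    have h3 : D * m ≤ 129 * m := mul_le_mul_of_nonneg_right (by linarith) h2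
    rw [Nat.zero_sub, zero_mul, add_zero]
    linarith
  set R := Nat.sqrt m
  have hR : R * R ≤ m := Nat.sqrt_le m
  have hR' : m < (R + 1) * (R + 1) := Nat.lt_succ_sqrt m
  have hdR : d ≤ R := Nat.le_sqrt.2 (by rwa [← sq])
  -- The divisors leave room in the budgets: blocks take at most `n / 8` vertices and the hub `n /
  -- 2`. Of the arcs, the blocks take at most about `m / 4`, the hub `m / 8`, and the arcs to the
  -- hub and the chain the rest.
  set k := d / 32 with hk
  set q := R / 2 with hq
  have hk1 : 32 * k ≤ d := by omega
  have hq1 : 2 * q ≤ R := by omega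
  have hr1 : 1 ≤ r := by
    by_contra h
    have : r = 0 := by omega
    rw [this] at hr'
    omega
  have hmn' : m ≤ n * n := by
    have := Nat.mul_le_mul_left n (Nat.sub_le n 1)
    omega
  have hRn : R ≤ n := by
    by_contra h
    have h1 : (n + 1) * (n + 1) ≤ R * R := Nat.mul_le_mul (by omega) (by omega)
    have h2 : (n + 1) * (n + 1) = n * n + (2 * n + 1) := by ring
    omega
  -- This is the bound `Δ^(3/2) ≤ n`, squared to avoid roots.
  have hdr : d * r ≤ n := by
    by_contra h
    have h1 : n < d * r := by omega
    have h2 : n ^ 2 < (d * r) ^ 2 := Nat.pow_lt_pow_left h1 two_ne_zero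
    have h3 : (d * r) ^ 2 ≤ d ^ 3 := by
      calc (d * r) ^ 2 = d ^ 2 * (r * r) := by ring
        _ ≤ d ^ 2 * d := Nat.mul_le_mul_left _ hr
        _ = d ^ 3 := by ring
    omega
  have hP : 2 * (q * (q - 1) / 2) = q * (q - 1) :=
    Nat.mul_div_cancel' (Nat.even_mul_pred_self q).two_dvd
  refine ⟨k, 2 * (r + 1), q, by omega, ?_, hsD, ?_, ?_⟩
  · have h1 : k * (2 * (r + 1)) ≤ 4 * (k * r) :=
      (Nat.mul_le_mul_left k (by omega)).trans_eq (show k * (4 * r) = 4 * (k * r) by ring)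
    have h2 : 32 * k * r ≤ d * r := Nat.mul_le_mul_right r hk1
    have h3 : 32 * k * r = 8 * (4 * (k * r)) := by ring
    omega
  · rw [hs]
    have h1 : (r + 1) * (2 * r + 1) ≤ 8 * d := by
      have h := Nat.mul_le_mul (show r + 1 ≤ 2 * r by omega) (show 2 * r + 1 ≤ 4 * r by omega)
      have h' : 2 * r * (4 * r) = 8 * (r * r) := by ring
      omega
    have h2 : k * ((r + 1) * (2 * r + 1)) ≤ k * (8 * d) := Nat.mul_le_mul_left k h1
    have h3 : 4 * (k * (8 * d)) ≤ d * d :=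
      (show 4 * (k * (8 * d)) = 32 * k * d by ring).trans_le (Nat.mul_le_mul_right d hk1)
    have h4 : d * d ≤ R * R := Nat.mul_le_mul hdR hdR
    have h5 : q * (q - 1) ≤ q * q := Nat.mul_le_mul_left q (Nat.sub_le q 1)
    have h6 : 4 * (q * q) ≤ R * R :=
      (show 4 * (q * q) = 2 * q * (2 * q) by ring).trans_le (Nat.mul_le_mul hq1 hq1)
    have h7 : 32 * k * (2 * q) ≤ R * R := Nat.mul_le_mul (by omega) hq1
    have h8 : 32 * k * (2 * q) = 64 * (k * q) := by ring
    have h9 : R ≤ R * R := Nat.le_mul_self R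
    omega
  -- Rounding costs constant factors: 64 for the length of the chain, 128 for the hub and 2 for `D ≤
  -- 2 * d`, with product 16384.
  · have h1 : d ≤ 64 * (k - 1) := by omega
    have h2 : R ≤ 4 * (q - 1) := by omega
    have h3 : R * R ≤ 4 * q * (4 * (q - 1)) := Nat.mul_le_mul (by omega) h2
    have h4 : 4 * q * (4 * (q - 1)) = 16 * (q * (q - 1)) := by ring
    have h5 : (R + 1) * (R + 1) ≤ 2 * R * (2 * R) := Nat.mul_le_mul (by omega) (by omega)
    have h6 : 2 * R * (2 * R) = 4 * (R * R) := by ring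
    have h7 : m ≤ 128 * (q * (q - 1) / 2) := by omega
    have h8 : d * m ≤ 64 * (k - 1) * (128 * (q * (q - 1) / 2)) := Nat.mul_le_mul h1 h7
    generalize q * (q - 1) / 2 = P at h8 ⊢
    have h9 : (d : ℝ) * m ≤ 8192 * (((k - 1) * P : ℕ) : ℝ) := by
      have : d * m ≤ 8192 * ((k - 1) * P) := h8.trans_eq (by ring)
      exact_mod_cast this
    have h10 : (128 : ℝ) ≤ d := by exact_mod_cast hlarge
    have h11 : (0 : ℝ) ≤ m := by positivity
    have h12 : D * m ≤ 2 * d * m := mul_le_mul_of_nonneg_right (by linarith) h11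
    rw [Nat.cast_add]
    linarith

end SparseCycle

/-! ### Assembly -/

theorem mainTheorem5 :
    ∃ c : ℝ, 0 < c ∧ ∀ n m : ℕ, m ≤ n * (n - 1) / 2 →
      ∀ i₀ : Fin n → ℤ, SparseCycle.IsInitialIndexing i₀ →
        ∃ arcs : List (Fin n × Fin n),
          arcs.length = m ∧ arcs.Nodup ∧ SparseCycle.IsAcyclicArcs arcs ∧
          (∃ r t, SparseCycle.Run (SparseCycle.searchBound n m)
            (SparseCycle.initState i₀) arcs r t) ∧
          ∀ r t, SparseCycle.Run (SparseCycle.searchBound n m)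
              (SparseCycle.initState i₀) arcs r t →
            r ≠ none ∧
            c * (min ((m : ℝ) ^ (1 / 2 : ℝ)) ((n : ℝ) ^ (2 / 3 : ℝ)) * m) ≤ (t : ℝ) := by
  refine ⟨1 / 16384, by norm_num, fun n m hmn i₀ hi => ?_⟩
  -- For `m = 0` the parameter `Δ` is zero, whereas the abort argument needs it positive.
  rcases Nat.eq_zero_or_pos m with rfl | hm
  · refine ⟨[], rfl, List.nodup_nil, fun x h => ?_, ⟨_, _, .nil⟩, fun r t h => ?_⟩
    · obtain ⟨y, _, h⟩ | h := h
      all_goals simp_all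
    · cases h
      simp
  have hn : 0 < n := by
    rcases Nat.eq_zero_or_pos n with rfl | h
    · simp at hmn; omega
    · exact h
  obtain ⟨k, s, q, hs, hq, hΔ, hbudget, hcost⟩ := SparseCycle.exists_parameters hmn
  obtain ⟨L, rfl⟩ := SparseCycle.exists_layout hi hn hs hq
  have hpos : 0 < SparseCycle.searchBound n m := by
    unfold SparseCycle.searchBound; positivity
  have hchain : (L.chain k).toFinset ⊆ SparseCycle.pairsLT L.key Finset.univ := by
    intro a ha
    obtain ⟨b, h1, h2, rfl⟩ := L.mem_chain (List.mem_toFinset.1 ha)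
    refine SparseCycle.mem_pairsLT.2 ⟨Finset.mem_univ _, Finset.mem_univ _, L.key_lt.2 (.inl ?_)⟩
    rw [L.block_first b h1 (by omega), L.block_last (b + 1) (by omega) h2]
    exact Nat.lt_succ_self b
  have hcore : L.core ⊆ SparseCycle.pairsLT L.key Finset.univ := fun a ha =>
    SparseCycle.mem_pairsLT.2 ⟨Finset.mem_univ _, Finset.mem_univ _, (L.of_mem_core ha).1⟩
  have hcard : (L.core ∪ (L.chain k).toFinset).card ≤ m := by
    have h1 := Finset.card_union_le L.core (L.chain k).toFinset
    have h2 := L.card_core_le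
    have h3 := List.toFinset_card_le (L.chain k)
    rw [L.length_chain] at h3
    omega
  -- Pad the core and the chain to exactly `m` arcs inside the complete acyclic graph of the final
  -- order, which has `n(n - 1)/2` arcs.
  obtain ⟨T, hT1, hT2, hTm⟩ := Finset.exists_subsuperset_card_eq
    (Finset.union_subset hcore hchain) hcard (by
      rw [SparseCycle.card_pairsLT L.key_injective, Finset.card_univ, Fintype.card_fin]
      exact hmn)
  obtain ⟨l, hl, hlT, hex, hall⟩ := L.exists_runsAtLeast (σ := SparseCycle.initState i₀) hpos hΔ
    (Finset.union_subset_left hT1)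
    (fun a ha => Finset.union_subset_right hT1 (List.mem_toFinset.2 ha)) hT2
    (fun _ => rfl) rfl (fun _ => rfl) (fun _ => rfl)
  refine ⟨l, by rw [← hTm, ← hlT, List.toFinset_card_of_nodup hl], hl, fun x hx => ?_, hex,
    fun r t hr => ⟨(hall r t hr).1, hcost.trans ?_⟩⟩
  · have hkey : ∀ a b, Relation.TransGen (fun a b => (a, b) ∈ l) a b → L.key a < L.key b := by
      intro a b hab
      have hstep : ∀ a b, (a, b) ∈ l → L.key a < L.key b := fun a b h =>
        (SparseCycle.mem_pairsLT.1 (hT2 (hlT ▸ List.mem_toFinset.2 h))).2.2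
      induction hab with
      | single h => exact hstep _ _ h
      | tail _ h ih => exact ih.trans (hstep _ _ h)
    exact lt_irrefl _ (hkey x x hx)
  · have := (hall r t hr).2
    rw [hTm] at this
    exact_mod_cast this
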